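/- Let $I=[0,1)$ and $\mathbb S^1=\mathbb R/\mathbb Z$. A group $G$ is *uniformly simple* if there is a positive integer $N$ such that for all $f,\phi\in G\setminus\{\mathrm{Id}\}$ the element $\phi$ is a product of at most $N$ elements of $G$, each of which is a conjugate in $G$ of $f$ or of $f^{-1}$. Let $\mathcal A^+(I)$ be the group (under composition) of affine interval exchange transformations, that is, of all bijections $f:I\to I$ for which there are a finite subdivision $0=a_1<a_2<\dots<a_{p+1}=1$ and reals $\lambda_i>0$, $\beta_i$ with $f(x)=\lambda_i x+\beta_i$ for all $x\in[a_i,a_{i+1})$, $i=1,\dots,p$. Let $\widehat{\mathcal A}(I)$ be the group of affine interval exchange transformations with flips, that is, of all bijections $f:I\to I$ for which there are a finite subdivision $0=a_1<a_2<\dots<a_{p+1}=1$ and reals $\lambda_i,\beta_i$ with $f(x)=\lambda_i x+\beta_i$ for all $x\in(a_i,a_{i+1})$, $i=1,\dots,p$. Let $\mathcal A(I)$ be the quotient of $\widehat{\mathcal A}(I)$ by its normal subgroup of elements $f$ with finite support $\{x\in I: f(x)\neq x\}$. Let $PL^+(\mathbb S^1)$ be the group of orientation preserving piecewise affine homeomorphisms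 of the circle, that is, of all homeomorphisms of $\mathbb S^1$ which, under the identification of $\mathbb S^1$ with $[0,1)$, belong to $\mathcal A^+(I)$. Then each of the groups $PL^+(\mathbb S^1)$, $\mathcal A(I)$ and $\mathcal A^+(I)$ is uniformly simple. -/

import Mathlib

/-- A group `G` is `N`-uniformly simple if, for all non-trivial `f, φ ∈ G`, the element `φ` is a
product of at most `N` elements of `G`, each of which is a conjugate in `G` of `f` or of `f⁻¹`. -/
def IsUniformlySimpleWith (N : ℕ) (G : Type*) [Group G] : Prop :=
  ∀ f φ : G, f ≠ 1 → φ ≠ 1 →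
    ∃ l : List G, l.length ≤ N ∧ (∀ x ∈ l, IsConj f x ∨ IsConj f⁻¹ x) ∧ l.prod = φ

/-- A group is uniformly simple if it is `N`-uniformly simple for some positive integer `N`. -/
def IsUniformlySimple (G : Type*) [Group G] : Prop :=
  ∃ N : ℕ, 0 < N ∧ IsUniformlySimpleWith N G

namespace IntervalExchange

/-- The half-open unit interval `I = [0,1)`. -/
abbrev I : Type := Set.Ico (0 : ℝ) 1

/-- `f` is given on `[c,d)` by an affine map with positive slope. -/
def IsDirectAffineOnIco (f : Equiv.Perm I) (c d : ℝ) : Prop :=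
  ∃ l b : ℝ, 0 < l ∧ ∀ x : I, c ≤ x → (x : ℝ) < d → (f x : ℝ) = l * x + b

/-- `f` is given on `(c,d)` by an affine map (of any slope). -/
def IsAffineOnIoo (f : Equiv.Perm I) (c d : ℝ) : Prop :=
  ∃ l b : ℝ, ∀ x : I, c < x → (x : ℝ) < d → (f x : ℝ) = l * x + b

/-- There is a finite subdivision `0 = a₀ < a₁ < ⋯ < aₚ = 1` such that `P aᵢ aᵢ₊₁` for all `i`. -/
def ExistsSubdivision (P : ℝ → ℝ → Prop) : Prop :=
  ∃ (p : ℕ) (a : Fin (p + 1) → ℝ), StrictMono a ∧ a 0 = 0 ∧ a (Fin.last p) = 1 ∧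
    ∀ i : Fin p, P (a i.castSucc) (a i.succ)

/-- Affine interval exchange transformations. (Piecewise continuity is automatic.) -/
def IsAIET (f : Equiv.Perm I) : Prop :=
  ExistsSubdivision (IsDirectAffineOnIco f)

/-- Affine interval exchange transformations with flips; nothing is asked about the values at the
subdivision points. (Piecewise continuity is automatic.) -/
def IsFAIET (f : Equiv.Perm I) : Prop :=
  ExistsSubdivision (IsAffineOnIoo f)

/-! Closure under composition and inversion. -/

theorem perm_apply_inv (f : Equiv.Perm I) (x : I) : f (f⁻¹ x) = x := f.apply_symm_apply x

theorem perm_inv_apply (f : Equiv.Perm I) (x : I) : f⁻¹ (f x) = x := f.symm_apply_apply x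

/-- In a subdivision of `[0,1)` every point lies in one of the half-open pieces. -/
theorem exists_piece {p : ℕ} {a : Fin (p + 1) → ℝ} (h0 : a 0 = 0) (h1 : a (Fin.last p) = 1)
    {x : ℝ} (hx0 : 0 ≤ x) (hx1 : x < 1) : ∃ i : Fin p, a i.castSucc ≤ x ∧ x < a i.succ := by
  by_contra hcon
  push Not at hcon
  have key : ∀ j : Fin (p + 1), a j ≤ x := by
    intro j
    induction j using Fin.induction with
    | zero => rw [h0]; exact hx0
    | succ i ih => exact hcon i ih
  have := key (Fin.last p)
  rw [h1] at this
  linarith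

/-- A property of intervals that passes to smaller intervals holds on the pieces of some
subdivision iff it holds on all intervals that avoid some finite set. -/
theorem existsSubdivision_iff {P : ℝ → ℝ → Prop}
    (hP : ∀ {c d c' d' : ℝ}, P c d → c ≤ c' → c' < d' → d' ≤ d → P c' d') :
    ExistsSubdivision P ↔ ∃ D : Finset ℝ, ∀ c d : ℝ, 0 ≤ c → c < d → d ≤ 1 →
      (∀ x ∈ D, ¬ (c < x ∧ x < d)) → P c d := by
  classical
  constructor
  · rintro ⟨p, a, -, h0, h1, h⟩
    refine ⟨Finset.univ.image a, fun c d hc hcd hd hD => ?_⟩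
    obtain ⟨i, hi, hi'⟩ := exists_piece h0 h1 hc (lt_of_lt_of_le hcd hd)
    refine hP (h i) hi hcd ?_
    by_contra hlt
    push Not at hlt
    exact hD _ (Finset.mem_image_of_mem _ (Finset.mem_univ _)) ⟨hi', hlt⟩
  · rintro ⟨D, hD⟩
    set E : Finset ℝ := insert 0 (insert 1 (D.filter fun x => 0 < x ∧ x < 1)) with hE
    have hmem : ∀ x, x ∈ E ↔ x = 0 ∨ x = 1 ∨ (x ∈ D ∧ 0 < x ∧ x < 1) := by
      intro x; simp [hE]
    have hE01 : ∀ x ∈ E, 0 ≤ x ∧ x ≤ 1 := by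
      intro x hx
      rcases (hmem x).1 hx with rfl | rfl | ⟨-, h, h'⟩
      · norm_num
      · norm_num
      · exact ⟨h.le, h'.le⟩
    have hE0 : (0 : ℝ) ∈ E := (hmem 0).2 (Or.inl rfl)
    have hE1 : (1 : ℝ) ∈ E := (hmem 1).2 (Or.inr (Or.inl rfl))
    obtain ⟨p, hp⟩ : ∃ p, E.card = p + 1 :=
      ⟨E.card - 1, by have := Finset.card_pos.2 ⟨_, hE0⟩; omega⟩
    have hrange : ∀ x ∈ E, ∃ j, E.orderEmbOfFin hp j = x := by
      intro x hx
      have : x ∈ Set.range (E.orderEmbOfFin hp) := by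
        rw [Finset.range_orderEmbOfFin]; exact hx
      exact this
    have hmono := (E.orderEmbOfFin hp).strictMono
    have hin := fun j => Finset.orderEmbOfFin_mem E hp j
    refine ⟨p, E.orderEmbOfFin hp, hmono, ?_, ?_, ?_⟩
    · obtain ⟨j, hj⟩ := hrange 0 hE0
      refine le_antisymm ?_ (hE01 _ (hin _)).1
      rw [← hj]; exact hmono.monotone (Fin.zero_le j)
    · obtain ⟨j, hj⟩ := hrange 1 hE1
      refine le_antisymm (hE01 _ (hin _)).2 ?_
      conv_lhs => rw [← hj]
      exact hmono.monotone (Fin.le_last j)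
    · intro i
      refine hD _ _ (hE01 _ (hin _)).1 (hmono Fin.castSucc_lt_succ) (hE01 _ (hin _)).2 ?_
      rintro x hx ⟨hx1, hx2⟩
      have hxE : x ∈ E := (hmem x).2 (Or.inr (Or.inr ⟨hx,
        lt_of_le_of_lt (hE01 _ (hin _)).1 hx1, lt_of_lt_of_le hx2 (hE01 _ (hin _)).2⟩))
      obtain ⟨j, rfl⟩ := hrange x hxE
      have h1 := hmono.lt_iff_lt.1 hx1
      have h2 := hmono.lt_iff_lt.1 hx2
      rw [Fin.lt_def] at h1 h2
      simp at h1 h2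
      omega

theorem isAIET_iff (f : Equiv.Perm I) :
    IsAIET f ↔ ∃ D : Finset ℝ, ∀ c d : ℝ, 0 ≤ c → c < d → d ≤ 1 →
      (∀ x ∈ D, ¬ (c < x ∧ x < d)) → IsDirectAffineOnIco f c d := by
  apply existsSubdivision_iff
  rintro c d c' d' ⟨l, b, hl, h⟩ hc _ hd
  exact ⟨l, b, hl, fun x hx hx' => h x (hc.trans hx) (hx'.trans_le hd)⟩

theorem isFAIET_iff (f : Equiv.Perm I) :
    IsFAIET f ↔ ∃ D : Finset ℝ, ∀ c d : ℝ, 0 ≤ c → c < d → d ≤ 1 →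
      (∀ x ∈ D, ¬ (c < x ∧ x < d)) → IsAffineOnIoo f c d := by
  apply existsSubdivision_iff
  rintro c d c' d' ⟨l, b, h⟩ hc _ hd
  exact ⟨l, b, fun x hx hx' => h x (hc.trans_lt hx) (hx'.trans_le hd)⟩

theorem isAIET_one : IsAIET 1 :=
  (isAIET_iff 1).2 ⟨∅, fun _ _ _ _ _ _ => ⟨1, 0, one_pos, fun x _ _ => by simp⟩⟩

theorem isFAIET_one : IsFAIET 1 :=
  (isFAIET_iff 1).2 ⟨∅, fun _ _ _ _ _ _ => ⟨1, 0, fun x _ _ => by simp⟩⟩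

/-- The slope of a bijection on a nondegenerate affine piece is not zero. -/
theorem slope_ne_zero {f : Equiv.Perm I} {c d l b : ℝ} (hc : 0 ≤ c) (hcd : c < d) (hd : d ≤ 1)
    (h : ∀ x : I, c < x → (x : ℝ) < d → (f x : ℝ) = l * x + b) : l ≠ 0 := by
  rintro rfl
  let x : I := ⟨(2 * c + d) / 3, by constructor <;> linarith⟩
  let y : I := ⟨(c + 2 * d) / 3, by constructor <;> linarith⟩
  have hx := h x (by change c < (2 * c + d) / 3; linarith)
    (by change (2 * c + d) / 3 < d; linarith)
  have hy := h y (by change c < (c + 2 * d) / 3; linarith)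
    (by change (c + 2 * d) / 3 < d; linarith)
  have hxy : f x = f y := Subtype.ext (by rw [hx, hy]; ring)
  have := congrArg Subtype.val (f.injective hxy)
  change (2 * c + d) / 3 = (c + 2 * d) / 3 at this
  linarith

/-- An affine function with values in `[0,1]` on an open interval has values in `[0,1]` at the
endpoints. -/
theorem affine_endpoints {c d l b : ℝ} (hcd : c < d)
    (h : ∀ x, c < x → x < d → 0 ≤ l * x + b ∧ l * x + b ≤ 1) :
    (0 ≤ l * c + b ∧ l * c + b ≤ 1) ∧ (0 ≤ l * d + b ∧ l * d + b ≤ 1) := by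
  have hcont : Continuous fun x : ℝ => l * x + b := by fun_prop
  have hcl : closure (Set.Ioo c d) ⊆ (fun x : ℝ => l * x + b) ⁻¹' Set.Icc 0 1 :=
    closure_minimal (fun x hx => h x hx.1 hx.2) (isClosed_Icc.preimage hcont)
  rw [closure_Ioo hcd.ne] at hcl
  exact ⟨hcl (Set.left_mem_Icc.2 hcd.le), hcl (Set.right_mem_Icc.2 hcd.le)⟩

theorem affine_endpoints_perm {f : Equiv.Perm I} {c d l b : ℝ}
    (hc : 0 ≤ c) (hcd : c < d) (hd : d ≤ 1)
    (h : ∀ x : I, c < x → (x : ℝ) < d → (f x : ℝ) = l * x + b) :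
    (0 ≤ l * c + b ∧ l * c + b ≤ 1) ∧ (0 ≤ l * d + b ∧ l * d + b ≤ 1) := by
  apply affine_endpoints hcd
  intro x hx hx'
  have := h ⟨x, by constructor <;> linarith⟩ hx hx'
  simp only at this
  rw [← this]
  exact ⟨(f _).2.1, (f _).2.2.le⟩

/-- The points of `I` that a permutation sends into a given finite set. -/
noncomputable def preimageFinset (g : Equiv.Perm I) (D : Finset ℝ) : Finset ℝ :=
  (D.preimage (fun x : I => (g x : ℝ))
    (Subtype.val_injective.comp g.injective).injOn).map (Function.Embedding.subtype _)

theorem mem_preimageFinset {g : Equiv.Perm I} {D : Finset ℝ} (x : I) (hx : (g x : ℝ) ∈ D) :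
    (x : ℝ) ∈ preimageFinset g D := by
  simp only [preimageFinset, Finset.mem_map, Finset.mem_preimage]
  exact ⟨x, hx, rfl⟩

theorem IsAIET.mul {f g : Equiv.Perm I} (hf : IsAIET f) (hg : IsAIET g) : IsAIET (f * g) := by
  classical
  rw [isAIET_iff] at hf hg ⊢
  obtain ⟨D, hD⟩ := hf
  obtain ⟨E, hE⟩ := hg
  refine ⟨E ∪ preimageFinset g D, fun c d hc hcd hd hav => ?_⟩
  obtain ⟨l, b, hl, h⟩ := hE c d hc hcd hd fun x hx => hav x (Finset.mem_union_left _ hx)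
  obtain ⟨⟨h1, -⟩, -, h4⟩ := affine_endpoints_perm hc hcd hd fun x hx hx' => h x hx.le hx'
  obtain ⟨l', b', hl', h'⟩ := hD (l * c + b) (l * d + b) h1 (by nlinarith) h4 (by
    rintro y hy ⟨hy1, hy2⟩
    have e : l * ((y - b) / l) + b = y := by field_simp; ring
    have hx1 : c < (y - b) / l := by rw [lt_div_iff₀ hl]; linarith
    have hx2 : (y - b) / l < d := by rw [div_lt_iff₀ hl]; linarith
    have hx := h ⟨(y - b) / l, by constructor <;> linarith⟩ hx1.le hx2
    refine hav ((y - b) / l) (Finset.mem_union_right _ ?_) ⟨hx1, hx2⟩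
    refine mem_preimageFinset (g := g) ⟨(y - b) / l, by constructor <;> linarith⟩ ?_
    rw [hx]; simpa only [e] using hy)
  refine ⟨l' * l, l' * b + b', mul_pos hl' hl, fun x hx hx' => ?_⟩
  have hgx := h x hx hx'
  rw [Equiv.Perm.mul_apply, h' (g x) (by rw [hgx]; nlinarith) (by rw [hgx]; nlinarith), hgx]
  ring

theorem IsFAIET.mul {f g : Equiv.Perm I} (hf : IsFAIET f) (hg : IsFAIET g) :
    IsFAIET (f * g) := by
  classical
  rw [isFAIET_iff] at hf hg ⊢
  obtain ⟨D, hD⟩ := hf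
  obtain ⟨E, hE⟩ := hg
  refine ⟨E ∪ preimageFinset g D, fun c d hc hcd hd hav => ?_⟩
  obtain ⟨l, b, h⟩ := hE c d hc hcd hd fun x hx => hav x (Finset.mem_union_left _ hx)
  obtain ⟨⟨h1, h2⟩, h3, h4⟩ := affine_endpoints_perm hc hcd hd h
  have hl0 : l ≠ 0 := slope_ne_zero hc hcd hd h
  have havoid : ∀ y ∈ D, ¬ (c < (y - b) / l ∧ (y - b) / l < d) := by
    rintro y hy ⟨hx1, hx2⟩
    have e : l * ((y - b) / l) + b = y := by field_simp; ring
    have hx := h ⟨(y - b) / l, by constructor <;> linarith⟩ hx1 hx2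
    refine hav ((y - b) / l) (Finset.mem_union_right _ ?_) ⟨hx1, hx2⟩
    refine mem_preimageFinset (g := g) ⟨(y - b) / l, by constructor <;> linarith⟩ ?_
    rw [hx]; simpa only [e] using hy
  rcases lt_or_gt_of_ne hl0 with hl | hl
  · obtain ⟨l', b', h'⟩ := hD (l * d + b) (l * c + b) h3 (by nlinarith) h2 (by
      rintro y hy ⟨hy1, hy2⟩
      refine havoid y hy ⟨?_, ?_⟩
      · rw [lt_div_iff_of_neg hl]; linarith
      · rw [div_lt_iff_of_neg hl]; linarith)
    refine ⟨l' * l, l' * b + b', fun x hx hx' => ?_⟩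
    have hgx := h x hx hx'
    rw [Equiv.Perm.mul_apply, h' (g x) (by rw [hgx]; nlinarith) (by rw [hgx]; nlinarith), hgx]
    ring
  · obtain ⟨l', b', h'⟩ := hD (l * c + b) (l * d + b) h1 (by nlinarith) h4 (by
      rintro y hy ⟨hy1, hy2⟩
      refine havoid y hy ⟨?_, ?_⟩
      · rw [lt_div_iff₀ hl]; linarith
      · rw [div_lt_iff₀ hl]; linarith)
    refine ⟨l' * l, l' * b + b', fun x hx hx' => ?_⟩
    have hgx := h x hx hx'
    rw [Equiv.Perm.mul_apply, h' (g x) (by rw [hgx]; nlinarith) (by rw [hgx]; nlinarith), hgx]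
    ring

theorem IsAIET.inv {f : Equiv.Perm I} (hf : IsAIET f) : IsAIET f⁻¹ := by
  classical
  rw [isAIET_iff]
  obtain ⟨p, a, hmono, h0, h1, h⟩ := hf
  choose l b hl h using h
  refine ⟨Finset.univ.image (fun i => l i * a i.castSucc + b i) ∪
    Finset.univ.image (fun i => l i * a i.succ + b i), fun c d hc hcd hd hav => ?_⟩
  let y : I := ⟨(c + d) / 2, by constructor <;> linarith⟩
  have hyv : (y : ℝ) = (c + d) / 2 := rfl
  obtain ⟨i, hi, hi'⟩ := exists_piece h0 h1 (f⁻¹ y).2.1 (f⁻¹ y).2.2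
  have hy := h i _ hi hi'
  rw [perm_apply_inv] at hy
  have hli := hl i
  have hm : l i * a i.castSucc + b i ≤ c := by
    have := hav (l i * a i.castSucc + b i) (Finset.mem_union_left _
      (Finset.mem_image_of_mem (fun i => l i * a i.castSucc + b i) (Finset.mem_univ i)))
    by_contra hlt
    exact this ⟨by linarith, by nlinarith⟩
  have hM : d ≤ l i * a i.succ + b i := by
    have := hav (l i * a i.succ + b i) (Finset.mem_union_right _
      (Finset.mem_image_of_mem (fun i => l i * a i.succ + b i) (Finset.mem_univ i)))
    by_contra hlt
    exact this ⟨by nlinarith, by linarith⟩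
  refine ⟨(l i)⁻¹, - b i / l i, inv_pos.2 hli, fun z hz hz' => ?_⟩
  have e : (l i)⁻¹ * (z : ℝ) + - b i / l i = (z - b i) / l i := by field_simp; ring
  have hx1 : a i.castSucc ≤ (z - b i) / l i := by rw [le_div_iff₀ hli]; linarith
  have hx2 : (z - b i) / l i < a i.succ := by rw [div_lt_iff₀ hli]; linarith
  have ha0 : 0 ≤ a i.castSucc := by rw [← h0]; exact hmono.monotone (Fin.zero_le _)
  have ha1 : a i.succ ≤ 1 := by rw [← h1]; exact hmono.monotone (Fin.le_last _)
  have hx := h i ⟨(z - b i) / l i, by constructor <;> linarith⟩ hx1 hx2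
  have hfz : f ⟨(z - b i) / l i, by constructor <;> linarith⟩ = z := by
    apply Subtype.ext
    rw [hx]
    field_simp
    ring
  rw [e, ← hfz, perm_inv_apply, hfz]

theorem IsFAIET.inv {f : Equiv.Perm I} (hf : IsFAIET f) : IsFAIET f⁻¹ := by
  classical
  rw [isFAIET_iff]
  obtain ⟨p, a, hmono, h0, h1, h⟩ := hf
  choose l b h using h
  have ha0 : ∀ j, 0 ≤ a j := fun j => by rw [← h0]; exact hmono.monotone (Fin.zero_le _)
  have ha1 : ∀ j, a j ≤ 1 := fun j => by rw [← h1]; exact hmono.monotone (Fin.le_last _)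
  have hl0 : ∀ i, l i ≠ 0 := fun i =>
    slope_ne_zero (ha0 _) (hmono Fin.castSucc_lt_succ) (ha1 _) (h i)
  refine ⟨(Finset.univ.image (fun i => l i * a i.castSucc + b i) ∪
    Finset.univ.image (fun i => l i * a i.succ + b i)) ∪
    preimageFinset f⁻¹ (Finset.univ.image a), fun c d hc hcd hd hav => ?_⟩
  let y : I := ⟨(c + d) / 2, by constructor <;> linarith⟩
  have hyv : (y : ℝ) = (c + d) / 2 := rfl
  obtain ⟨i, hi, hi'⟩ := exists_piece h0 h1 (f⁻¹ y).2.1 (f⁻¹ y).2.2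
  have hi : a i.castSucc < (f⁻¹ y : I) := by
    refine lt_of_le_of_ne hi fun heq => ?_
    refine hav y (Finset.mem_union_right _ (mem_preimageFinset y ?_))
      ⟨by rw [hyv]; linarith, by rw [hyv]; linarith⟩
    rw [← heq]
    exact Finset.mem_image_of_mem _ (Finset.mem_univ _)
  have hy := h i _ hi hi'
  rw [perm_apply_inv] at hy
  have hm := hav (l i * a i.castSucc + b i) (Finset.mem_union_left _ (Finset.mem_union_left _
      (Finset.mem_image_of_mem (fun i => l i * a i.castSucc + b i) (Finset.mem_univ i))))
  have hM := hav (l i * a i.succ + b i) (Finset.mem_union_left _ (Finset.mem_union_right _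
      (Finset.mem_image_of_mem (fun i => l i * a i.succ + b i) (Finset.mem_univ i))))
  have hpiece : ∀ z : ℝ, c < z → z < d →
      a i.castSucc < (z - b i) / l i ∧ (z - b i) / l i < a i.succ := by
    intro z hz hz'
    rcases lt_or_gt_of_ne (hl0 i) with hl | hl
    · have hm' : d ≤ l i * a i.castSucc + b i := by
        by_contra hlt
        exact hm ⟨by nlinarith, by linarith⟩
      have hM' : l i * a i.succ + b i ≤ c := by
        by_contra hlt
        exact hM ⟨by linarith, by nlinarith⟩
      constructor
      · rw [lt_div_iff_of_neg hl]; linarith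
      · rw [div_lt_iff_of_neg hl]; linarith
    · have hm' : l i * a i.castSucc + b i ≤ c := by
        by_contra hlt
        exact hm ⟨by linarith, by nlinarith⟩
      have hM' : d ≤ l i * a i.succ + b i := by
        by_contra hlt
        exact hM ⟨by nlinarith, by linarith⟩
      constructor
      · rw [lt_div_iff₀ hl]; linarith
      · rw [div_lt_iff₀ hl]; linarith
  refine ⟨(l i)⁻¹, - b i / l i, fun z hz hz' => ?_⟩
  have hli := hl0 i
  have e : (l i)⁻¹ * (z : ℝ) + - b i / l i = (z - b i) / l i := by field_simp; ring
  obtain ⟨hx1, hx2⟩ := hpiece z hz hz'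
  have hI : (z - b i) / l i ∈ Set.Ico (0 : ℝ) 1 :=
    ⟨(ha0 _).trans hx1.le, hx2.trans_le (ha1 _)⟩
  have hx := h i ⟨(z - b i) / l i, hI⟩ hx1 hx2
  have hfz : f ⟨(z - b i) / l i, hI⟩ = z := by
    apply Subtype.ext
    rw [hx]
    field_simp
    ring
  rw [e, ← hfz, perm_inv_apply, hfz]

/-! The groups. -/

/-- The group `𝒜⁺(I)` of affine interval exchange transformations of `I = [0,1)`. -/
def AffinePlus : Subgroup (Equiv.Perm I) where
  carrier := {f | IsAIET f}
  one_mem' := isAIET_one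
  mul_mem' := IsAIET.mul
  inv_mem' := IsAIET.inv

/-- The group of affine interval exchange transformations with flips, as actual bijections. -/
def AffineFlipHat : Subgroup (Equiv.Perm I) where
  carrier := {f | IsFAIET f}
  one_mem' := isFAIET_one
  mul_mem' := IsFAIET.mul
  inv_mem' := IsFAIET.inv

/-- The group of bijections of `I` that move only finitely many points. -/
def FinitelySupported : Subgroup (Equiv.Perm I) where
  carrier := {f | {x | f x ≠ x}.Finite}
  one_mem' := by simp
  mul_mem' := by
    intro f g hf hg
    refine (hf.union hg).subset fun x hx => ?_
    by_contra hcon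
    simp only [Set.mem_union, Set.mem_ofPred_eq, not_or, not_not] at hcon
    exact hx (by rw [Equiv.Perm.mul_apply, hcon.2, hcon.1])
  inv_mem' := by
    intro f hf
    refine Set.Finite.subset hf fun x hx hfx => hx ?_
    rw [Equiv.Perm.inv_eq_iff_eq, hfx]

instance : FinitelySupported.Normal where
  conj_mem f hf g := by
    refine (Set.Finite.image g hf).subset fun x hx => ⟨g⁻¹ x, fun h => hx ?_, by simp⟩
    rw [Equiv.Perm.mul_apply, Equiv.Perm.mul_apply, h, perm_apply_inv]

/-- The group `𝒜(I)` of classes of affine interval exchange transformations with flips, two of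
them being in the same class if they differ at finitely many points only. -/
abbrev AffineFlip : Type := AffineFlipHat ⧸ FinitelySupported.subgroupOf AffineFlipHat

/-- The usual identification of the circle `𝕊¹ = ℝ/ℤ` with `I = [0,1)`. -/
noncomputable def circleEquivI : UnitAddCircle ≃ I :=
  (AddCircle.equivIco (1 : ℝ) 0).trans (Equiv.setCongr (by rw [zero_add]))

/-- A homeomorphism of the circle, read as a bijection of `I = [0,1)`. -/
noncomputable def readOnI : (UnitAddCircle ≃ₜ UnitAddCircle) →* Equiv.Perm I where
  toFun h := circleEquivI.permCongr h.toEquiv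
  map_one' := by ext x; simp [Equiv.permCongr_apply]
  map_mul' h k := by ext x; simp [Equiv.permCongr_apply]

/-- The group `PL⁺(𝕊¹)` of orientation preserving piecewise affine homeomorphisms of the circle:
the homeomorphisms of `ℝ/ℤ` that, read on `[0,1)`, are affine with positive slopes on the pieces
of a finite subdivision. -/
noncomputable def PLPlusCircle : Subgroup (UnitAddCircle ≃ₜ UnitAddCircle) :=
  AffinePlus.comap readOnI

end IntervalExchange

/-! Let `G` be `𝒜⁺(I)`, or `PL⁺(𝕊¹)` read on `[0,1)`, let `f ≠ 1` in `G`, and call an element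
compactly supported if it is the identity off some `[p,q)` with `0 < p < q < 1`. Three facts bound
the number of conjugates of `f^{±1}` needed.

Displacement by `f`: a nontrivial `f` carries some interval off itself, and `G` moves any `[p,q)` as
above into that interval. If `a` and `b` live on a displaced interval, then `f a f⁻¹` commutes with
`a` and `b`, and `⁅a⁻¹, b⁆` is a product of four conjugates of `f^{±1}`. So every commutator of
compactly supported elements costs four (`IsRich.conjProd_commutator`).

Perfectness with bounded length: a compactly supported element is a product of commutators of
elements of slightly larger support (`IsRich.inf_fixingOff_le`). It suffices to treat generators. A
two-piece increasing map with small breaks is itself a commutator, and the exchange of two halves is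
conjugate to the product of two conjugates of itself, hence dies in the abelianization. A push into
a disjoint interval then compresses any product of commutators to two (`exists_two_commutators`), so
compactly supported elements cost eight.

Fragmentation: any `φ` in `G` agrees on a small interval with a compactly supported `ψ`. Then `ψ⁻¹φ`
fixes an interval, and a rotation conjugates it to a compactly supported element. Thus `φ` costs
sixteen (`IsRich.conjProd`).

For `𝒜(I)` one reduces to `𝒜⁺(I)`. If `f` is nontrivial and `u` exchanges the halves of a small
interval, then `f u f⁻¹` exchanges the halves of its image, even if `f` reverses the interval,
because a half exchange commutes with reflection up to finitely many points. So `⁅f, u⁆` is a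
nontrivial element `θ` of `𝒜⁺(I)`, and all of `𝒜⁺(I)` costs `2 * 16`. Conversely, reversing the
decreasing pieces of `φ` is, up to finitely many points, a product of three conjugates of elements
of `𝒜⁺(I)`, and what remains has positive slopes. This gives `4 * 32 = 128`. -/

/-! ### Products of conjugates and commutators -/

section GroupTheory

open scoped commutatorElement

variable {P : Type*} [Group P]

/-- `x` is a product of at most `n` conjugates of `f` or `f⁻¹` by elements of `G`. -/
inductive ConjProd (G : Subgroup P) (f : P) : ℕ → P → Prop
  | one (n : ℕ) : ConjProd G f n 1
  | conj_mul {n : ℕ} {y : P} (g : P) (hg : g ∈ G) (h : ConjProd G f n y) :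
      ConjProd G f (n + 1) (g * f * g⁻¹ * y)
  | conj_inv_mul {n : ℕ} {y : P} (g : P) (hg : g ∈ G) (h : ConjProd G f n y) :
      ConjProd G f (n + 1) (g * f⁻¹ * g⁻¹ * y)

namespace ConjProd

variable {G : Subgroup P} {f : P} {n m : ℕ} {x y : P}

theorem mul (hx : ConjProd G f n x) (hy : ConjProd G f m y) :
    ConjProd G f (n + m) (x * y) := by
  induction hx with
  | one n =>
    rw [one_mul]
    induction hy with
    | one k => exact one _
    | conj_mul g hg _ ih => exact conj_mul g hg ih
    | conj_inv_mul g hg _ ih => exact conj_inv_mul g hg ih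
  | conj_mul g hg _ ih =>
    rw [mul_assoc, Nat.add_right_comm]
    exact conj_mul g hg ih
  | conj_inv_mul g hg _ ih =>
    rw [mul_assoc, Nat.add_right_comm]
    exact conj_inv_mul g hg ih

theorem of_conj {g : P} (hg : g ∈ G) : ConjProd G f 1 (g * f * g⁻¹) := by
  simpa using conj_mul g hg (one (G := G) (f := f) 0)

theorem of_conj_inv {g : P} (hg : g ∈ G) : ConjProd G f 1 (g * f⁻¹ * g⁻¹) := by
  simpa using conj_inv_mul g hg (one (G := G) (f := f) 0)

theorem conj (hx : ConjProd G f n x) {k : P} (hk : k ∈ G) : ConjProd G f n (k * x * k⁻¹) := by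
  induction hx with
  | one n => simpa using one n
  | @conj_mul n y g hg _ ih =>
    have := conj_mul (k * g) (G.mul_mem hk hg) ih
    convert this using 1
    group
  | @conj_inv_mul n y g hg _ ih =>
    have := conj_inv_mul (k * g) (G.mul_mem hk hg) ih
    convert this using 1
    group

theorem inv (hx : ConjProd G f n x) : ConjProd G f n x⁻¹ := by
  induction hx with
  | one n => simpa using one n
  | @conj_mul n y g hg _ ih =>
    have := ih.mul (of_conj_inv (f := f) hg)
    convert this using 1
    group
  | @conj_inv_mul n y g hg _ ih =>
    have := ih.mul (of_conj (f := f) hg)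
    convert this using 1
    group

theorem trans {θ : P} (hθ : ConjProd G f m θ) (hx : ConjProd G θ n x) :
    ConjProd G f (m * n) x := by
  induction hx with
  | one n => exact one _
  | conj_mul g hg _ ih =>
    rw [Nat.mul_succ, add_comm]
    exact (hθ.conj hg).mul ih
  | conj_inv_mul g hg _ ih =>
    rw [Nat.mul_succ, add_comm]
    exact (hθ.inv.conj hg).mul ih

theorem map {Q : Type*} [Group Q] (χ : P →* Q) (hx : ConjProd G f n x) :
    ConjProd (⊤ : Subgroup Q) (χ f) n (χ x) := by
  induction hx with
  | one n => simpa using one n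
  | conj_mul g hg _ ih => simpa using conj_mul (χ g) (Subgroup.mem_top _) ih
  | conj_inv_mul g hg _ ih => simpa using conj_inv_mul (χ g) (Subgroup.mem_top _) ih

/-- The conjugators lie in the range of `χ`, so the whole product can be lifted factor by factor.
This lets all computations take place among bijections of `[0,1)`. -/
theorem comap {H : Type*} [Group H] {f : H} {x : P} (χ : H →* P)
    (hx : ConjProd χ.range (χ f) n x) : ∃ y, χ y = x ∧ ConjProd ⊤ f n y := by
  induction hx with
  | one n => exact ⟨1, map_one χ, one n⟩
  | conj_mul g hg _ ih =>
    obtain ⟨g, rfl⟩ := hg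
    obtain ⟨y, rfl, hy⟩ := ih
    exact ⟨g * f * g⁻¹ * y, by simp, conj_mul g (Subgroup.mem_top g) hy⟩
  | conj_inv_mul g hg _ ih =>
    obtain ⟨g, rfl⟩ := hg
    obtain ⟨y, rfl, hy⟩ := ih
    exact ⟨g * f⁻¹ * g⁻¹ * y, by simp, conj_inv_mul g (Subgroup.mem_top g) hy⟩

theorem comap_of_injective {H : Type*} [Group H] {f x : H} {χ : H →* P}
    (hχ : Function.Injective χ) (hG : χ.range = G) (hx : ConjProd G (χ f) n (χ x)) :
    ConjProd ⊤ f n x := by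
  subst hG
  obtain ⟨y, hy, h⟩ := hx.comap
  rwa [← hχ hy]

theorem exists_list (hx : ConjProd G f n x) :
    ∃ l : List P, l.length ≤ n ∧ (∀ y ∈ l, IsConj f y ∨ IsConj f⁻¹ y) ∧ l.prod = x := by
  induction hx with
  | one n => exact ⟨[], by simp⟩
  | conj_mul g hg _ ih =>
    obtain ⟨l, h1, h2, h3⟩ := ih
    refine ⟨(g * f * g⁻¹) :: l, by simpa using h1, ?_, by simp [h3]⟩
    intro y hy
    rcases List.mem_cons.1 hy with rfl | hy
    · exact Or.inl (isConj_iff.2 ⟨g, rfl⟩)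
    · exact h2 y hy
  | conj_inv_mul g hg _ ih =>
    obtain ⟨l, h1, h2, h3⟩ := ih
    refine ⟨(g * f⁻¹ * g⁻¹) :: l, by simpa using h1, ?_, by simp [h3]⟩
    intro y hy
    rcases List.mem_cons.1 hy with rfl | hy
    · exact Or.inr (isConj_iff.2 ⟨g, rfl⟩)
    · exact h2 y hy

end ConjProd

/-- A group embedded with image `χ.range` is uniformly simple if, in the ambient group, elements
of the image are products of boundedly many conjugates. -/
theorem isUniformlySimple_of_conjProd {H : Type*} [Group H] (χ : H →* P)
    (hχ : Function.Injective χ) {N : ℕ} (hN : 0 < N)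
    (h : ∀ f ∈ χ.range, f ≠ 1 → ∀ φ ∈ χ.range, ConjProd χ.range f N φ) :
    IsUniformlySimple H := by
  refine ⟨N, hN, fun f φ hf _ => ?_⟩
  exact ((h (χ f) ⟨f, rfl⟩ (by rwa [Ne, map_eq_one_iff χ hχ]) (χ φ)
    ⟨φ, rfl⟩).comap_of_injective hχ rfl).exists_list

/-- If conjugation by `f` makes `a` commute with `a` and `b`, then the commutator of `a⁻¹` and
`b` is a product of four conjugates of `f` and `f⁻¹`. -/
theorem conjProd_commutator {G : Subgroup P} {f a b : P} (ha : a ∈ G) (hb : b ∈ G)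
    (haa : Commute (f * a * f⁻¹) a) (hab : Commute (f * a * f⁻¹) b) :
    ConjProd G f 4 ⁅a⁻¹, b⁆ := by
  -- The factor `f a f⁻¹` commutes with `a⁻¹ b a`, so putting it in front of `a⁻¹` leaves the
  -- commutator unchanged. The new first entry is `f * (a f⁻¹ a⁻¹)`, whence four conjugates.
  have key : ⁅a⁻¹, b⁆ = ⁅f * a * f⁻¹ * a⁻¹, b⁆ := by
    have h1 : Commute (f * a * f⁻¹) (a⁻¹ * b * a) :=
      (haa.inv_right.mul_right hab).mul_right haa
    rw [commutatorElement_def, commutatorElement_def]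
    calc a⁻¹ * b * a⁻¹⁻¹ * b⁻¹
        = (a⁻¹ * b * a) * b⁻¹ := by group
      _ = (f * a * f⁻¹) * (a⁻¹ * b * a) * (f * a * f⁻¹)⁻¹ * b⁻¹ := by
          rw [h1.eq]; group
      _ = _ := by group
  have h := ((ConjProd.of_conj (f := f) G.one_mem).mul (ConjProd.of_conj_inv (f := f) ha)).mul
    (((ConjProd.of_conj (f := f) (G.mul_mem hb ha)).mul (ConjProd.of_conj_inv (f := f) hb)))
  rw [key]
  convert h using 1
  rw [commutatorElement_def]
  group

/-- Displacement: if `H` is pushed by `t` into a group `V` which commutes with `H` and is preserved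
by `t`, then products of commutators of `H` are products of two commutators. -/
theorem exists_two_commutators {H V L : Subgroup P} {t y : P} (hHL : H ≤ L) (hVL : V ≤ L)
    (ht : t ∈ L) (hHV : ∀ a ∈ H, ∀ b ∈ V, Commute a b) (htH : ∀ a ∈ H, t * a * t⁻¹ ∈ V)
    (htV : ∀ a ∈ V, t * a * t⁻¹ ∈ V) (hy : y ∈ ⁅H, H⁆) :
    ∃ F ∈ L, ∃ A ∈ L, ∃ B ∈ L, y = ⁅F, t⁆ * ⁅A, B⁆ := by
  have hHH : ⁅H, H⁆ ≤ H := Subgroup.commutator_le_self H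
  suffices h : y ∈ H ∧ ∃ F ∈ L, ∃ A ∈ V, ∃ B ∈ V, y = ⁅F, t⁆ * ⁅A, B⁆ by
    obtain ⟨-, F, hF, A, hA, B, hB, h⟩ := h
    exact ⟨F, hF, A, hVL hA, B, hVL hB, h⟩
  have step : ∀ a ∈ H, ∀ b ∈ H, ∀ y : P,
      (y ∈ H ∧ ∃ F ∈ L, ∃ A ∈ V, ∃ B ∈ V, y = ⁅F, t⁆ * ⁅A, B⁆) →
      (⁅a, b⁆ * y ∈ H ∧ ∃ F ∈ L, ∃ A ∈ V, ∃ B ∈ V, ⁅a, b⁆ * y = ⁅F, t⁆ * ⁅A, B⁆) := by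
    rintro a ha b hb y ⟨hyH, F, hF, A, hA, B, hB, h⟩
    have hc : ⁅a, b⁆ ∈ H := hHH (Subgroup.commutator_mem_commutator ha hb)
    have hcy := H.mul_mem hc hyH
    have hAB : ⁅A, B⁆ ∈ V :=
      Subgroup.commutator_le_self V (Subgroup.commutator_mem_commutator hA hB)
    have htc : ∀ z ∈ H, ∀ w ∈ V, t * (z * w) * t⁻¹ ∈ V := fun z hz w hw => by
      have := V.mul_mem (htH z hz) (htV w hw)
      convert this using 1
      group
    -- The pair `(a, b)` is absorbed into `(A, B)`, which commutes with it, and everything is pushed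
    -- by `t` into `V`. The new first entry is chosen so that its commutator with `t` undoes the
    -- push and leaves `⁅a, b⁆ * y`.
    refine ⟨hcy, ⁅a, b⁆ * y * (t * F * t⁻¹),
      L.mul_mem (hHL hcy) (L.mul_mem (L.mul_mem ht hF) (L.inv_mem ht)),
      t * (a * A) * t⁻¹, htc a ha A hA, t * (b * B) * t⁻¹, htc b hb B hB, ?_⟩
    have e1 : ⁅a * A, b * B⁆ = ⁅a, b⁆ * ⁅A, B⁆ := by
      have h1 := (hHV b hb A hA).eq
      have h2 : Commute (a⁻¹ * b⁻¹) (A * B * A⁻¹) :=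
        (((hHV _ (H.mul_mem (H.inv_mem ha) (H.inv_mem hb)) _
          (V.mul_mem (V.mul_mem hA hB) (V.inv_mem hA)))))
      have h3 : Commute a⁻¹ A⁻¹ := hHV _ (H.inv_mem ha) _ (V.inv_mem hA)
      have h4 : Commute b⁻¹ B⁻¹ := hHV _ (H.inv_mem hb) _ (V.inv_mem hB)
      have h5 : Commute b⁻¹ A⁻¹ := hHV _ (H.inv_mem hb) _ (V.inv_mem hA)
      have h6 : Commute b⁻¹ (B * A⁻¹) := hHV _ (H.inv_mem hb) _ (V.mul_mem hB (V.inv_mem hA))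
      rw [commutatorElement_def, commutatorElement_def, commutatorElement_def]
      calc a * A * (b * B) * (a * A)⁻¹ * (b * B)⁻¹
          = a * (A * b) * B * (A⁻¹ * a⁻¹) * (B⁻¹ * b⁻¹) := by group
        _ = a * (b * A) * B * (a⁻¹ * A⁻¹) * (b⁻¹ * B⁻¹) := by rw [← h1, ← h3.eq, ← h4.eq]
        _ = a * b * (A * B * a⁻¹) * (A⁻¹ * b⁻¹) * B⁻¹ := by group
        _ = a * b * (A * B * a⁻¹) * (b⁻¹ * A⁻¹) * B⁻¹ := by rw [← h5.eq]
        _ = a * b * (A * B * (a⁻¹ * b⁻¹)) * A⁻¹ * B⁻¹ := by group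
        _ = a * b * ((a⁻¹ * b⁻¹) * (A * B)) * A⁻¹ * B⁻¹ := by
            rw [(hHV _ (H.mul_mem (H.inv_mem ha) (H.inv_mem hb)) _ (V.mul_mem hA hB)).eq]
        _ = _ := by group
    have e2 : ⁅t * (a * A) * t⁻¹, t * (b * B) * t⁻¹⁆ = t * (⁅a, b⁆ * ⁅A, B⁆) * t⁻¹ := by
      rw [← e1, commutatorElement_def, commutatorElement_def]
      group
    rw [e2]
    have e3 : F * t * F⁻¹ * t⁻¹ = y * ⁅A, B⁆⁻¹ := by
      rw [h, commutatorElement_def F t]; group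
    have e4 : Commute y⁻¹ ⁅A, B⁆⁻¹ := hHV _ (H.inv_mem hyH) _ (V.inv_mem hAB)
    rw [commutatorElement_def (⁅a, b⁆ * y * (t * F * t⁻¹))]
    symm
    calc ⁅a, b⁆ * y * (t * F * t⁻¹) * t * (⁅a, b⁆ * y * (t * F * t⁻¹))⁻¹ * t⁻¹ *
          (t * (⁅a, b⁆ * ⁅A, B⁆) * t⁻¹)
        = ⁅a, b⁆ * y * t * (F * t * F⁻¹ * t⁻¹) * y⁻¹ * ⁅A, B⁆ * t⁻¹ := by group
      _ = ⁅a, b⁆ * y * t * y * (⁅A, B⁆⁻¹ * y⁻¹) * ⁅A, B⁆ * t⁻¹ := by rw [e3]; group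
      _ = ⁅a, b⁆ * y * t * y * (y⁻¹ * ⁅A, B⁆⁻¹) * ⁅A, B⁆ * t⁻¹ := by rw [← e4.eq]
      _ = ⁅a, b⁆ * y := by group
  rw [Subgroup.commutator_def] at hy
  induction hy using Subgroup.closure_induction_left with
  | one => exact ⟨H.one_mem, 1, L.one_mem, 1, V.one_mem, 1, V.one_mem, by simp⟩
  | mul_left x hx y _ ih =>
    obtain ⟨a, ha, b, hb, rfl⟩ := hx
    exact step a ha b hb y ih
  | inv_mul_cancel x hx y _ ih =>
    obtain ⟨a, ha, b, hb, rfl⟩ := hx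
    rw [commutatorElement_inv]
    exact step b hb a ha y ih

/-- The commutator subgroup of `H` is stable under conjugation by elements of `H`. -/
theorem conj_mem_commutator {H : Subgroup P} {g x : P} (hg : g ∈ H) (hx : x ∈ ⁅H, H⁆) :
    g * x * g⁻¹ ∈ ⁅H, H⁆ := by
  have h := Subgroup.commutator_mem_commutator hg (Subgroup.commutator_le_self H hx)
  have := Subgroup.mul_mem _ h hx
  rwa [commutatorElement_def, inv_mul_cancel_right] at this

/-- An element that is conjugate to the product of two of its conjugates is a product of
commutators. -/
theorem mem_commutator_of_conj_mul_conj {H : Subgroup P} {x g₁ g₂ k : P} (hx : x ∈ H)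
    (h₁ : g₁ ∈ H) (h₂ : g₂ ∈ H) (hk : k ∈ H)
    (h : x = k * ((g₁ * x * g₁⁻¹) * (g₂ * x * g₂⁻¹)) * k⁻¹) : x ∈ ⁅H, H⁆ := by
  rw [← Subgroup.map_subtype_commutator]
  refine ⟨⟨x, hx⟩, ?_, rfl⟩
  have h' : (⟨x, hx⟩ : H) = ⟨k, hk⟩ * ((⟨g₁, h₁⟩ * ⟨x, hx⟩ * ⟨g₁, h₁⟩⁻¹) *
      (⟨g₂, h₂⟩ * ⟨x, hx⟩ * ⟨g₂, h₂⟩⁻¹)) * ⟨k, hk⟩⁻¹ := Subtype.ext h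
  have h'' := congrArg (Abelianization.of : H →* _) h'
  simp only [map_mul, map_inv, mul_inv_cancel_comm] at h''
  -- In the abelianization the hypothesis reads `x = x * x`.
  have h1 : Abelianization.of (⟨x, hx⟩ : H) = 1 := by simpa using h''
  rw [← Abelianization.ker_of]
  exact h1

end GroupTheory

namespace IntervalExchange

/-! ### Affine pieces -/

/-- `f` maps `[c,d)` into `[c',d')` by the increasing affine map taking endpoints to endpoints. -/
def MapsAffinely (f : Equiv.Perm I) (c d c' d' : ℝ) : Prop :=
  ∀ x : I, c ≤ x → (x : ℝ) < d → (f x : ℝ) = c' + (d' - c') / (d - c) * (x - c)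

namespace MapsAffinely

variable {f g : Equiv.Perm I} {c d c' d' c'' d'' u v u' v' : ℝ}

theorem mem (h : MapsAffinely f c d c' d') (h' : c' < d') {x : I} (hx : c ≤ x) (hx' : (x : ℝ) < d) :
    c' ≤ f x ∧ (f x : ℝ) < d' := by
  have hcd : 0 < d - c := by linarith
  rw [h x hx hx']
  have h1 : 0 ≤ (x - c) / (d - c) := div_nonneg (by linarith) hcd.le
  have h2 : (x - c) / (d - c) < 1 := by rw [div_lt_one hcd]; linarith
  have e : c' + (d' - c') / (d - c) * (x - c) = c' + (d' - c') * ((x - c) / (d - c)) := by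
    field_simp
  rw [e]
  constructor <;> nlinarith

theorem mul (hg : MapsAffinely g c' d' c'' d'') (hf : MapsAffinely f c d c' d') (h' : c' < d') :
    MapsAffinely (g * f) c d c'' d'' := by
  intro x hx hx'
  obtain ⟨h1, h2⟩ := hf.mem h' hx hx'
  rw [Equiv.Perm.mul_apply, hg _ h1 h2, hf x hx hx']
  have : d' - c' ≠ 0 := by linarith
  have : d - c ≠ 0 := by linarith
  field_simp
  ring

/-- The last two hypotheses say, with denominators cleared, that `u'` and `v'` are the images of `u`
and `v`; in concrete cases they are settled by `ring` or `norm_num`. -/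
theorem sub (hf : MapsAffinely f c d c' d') (hcu : c ≤ u) (huv : u < v) (hvd : v ≤ d)
    (hu : (u' - c') * (d - c) = (d' - c') * (u - c))
    (hv : (v' - c') * (d - c) = (d' - c') * (v - c)) : MapsAffinely f u v u' v' := by
  intro x hx hx'
  rw [hf x (hcu.trans hx) (hx'.trans_le hvd)]
  have h1 : d - c ≠ 0 := by linarith
  have h2 : v - u ≠ 0 := by linarith
  have eu : u' = c' + (d' - c') * (u - c) / (d - c) := by
    field_simp
    linarith
  have ev : v' = c' + (d' - c') * (v - c) / (d - c) := by
    field_simp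
    linarith
  rw [eu, ev]
  field_simp
  ring

theorem exists_sub (hf : MapsAffinely f c d c' d') (h' : c' < d') (hcu : c ≤ u) (huv : u < v)
    (hvd : v ≤ d) : ∃ u' v', c' ≤ u' ∧ u' < v' ∧ v' ≤ d' ∧ MapsAffinely f u v u' v' := by
  have h1 : 0 < d - c := by linarith
  have h2 : 0 < (d' - c') / (d - c) := div_pos (by linarith) h1
  have h3 : (d' - c') / (d - c) * (d - c) = d' - c' := by field_simp
  refine ⟨c' + (d' - c') / (d - c) * (u - c), c' + (d' - c') / (d - c) * (v - c), ?_, ?_, ?_,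
    hf.sub hcu huv hvd ?_ ?_⟩
  · nlinarith
  · nlinarith
  · nlinarith
  · field_simp; ring
  · field_simp; ring

theorem inv (hf : MapsAffinely f c d c' d') (hcd : c < d) (h' : c' < d') (hc : 0 ≤ c) (hd : d ≤ 1) :
    MapsAffinely f⁻¹ c' d' c d := by
  intro y hy hy'
  have h1 : 0 < d - c := by linarith
  have h1' : 0 < d' - c' := by linarith
  have h2 : 0 ≤ (y - c') / (d' - c') := div_nonneg (by linarith) h1'.le
  have h3 : (y - c') / (d' - c') < 1 := by rw [div_lt_one h1']; linarith
  have e : c + (d - c) / (d' - c') * (y - c') = c + (d - c) * ((y - c') / (d' - c')) := by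
    field_simp
  rw [e]
  have hx1 : c ≤ c + (d - c) * ((y - c') / (d' - c')) := by nlinarith
  have hx2 : c + (d - c) * ((y - c') / (d' - c')) < d := by nlinarith
  have := hf ⟨c + (d - c) * ((y - c') / (d' - c')), by constructor <;> linarith⟩ hx1 hx2
  have hfx : f ⟨c + (d - c) * ((y - c') / (d' - c')), by constructor <;> linarith⟩ = y := by
    apply Subtype.ext
    rw [this]
    field_simp
    ring
  rw [← hfx, perm_inv_apply]
  simp only [hfx]

theorem apply_eq (hf : MapsAffinely f c d c' d') (hg : MapsAffinely g c d c' d') {x : I} (hx : c ≤ x)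
    (hx' : (x : ℝ) < d) : f x = g x :=
  Subtype.ext (by rw [hf x hx hx', hg x hx hx'])

theorem apply_eq_self (hf : MapsAffinely f c d c d) {x : I} (hx : c ≤ x) (hx' : (x : ℝ) < d) :
    f x = x := by
  apply Subtype.ext
  have : d - c ≠ 0 := by linarith
  rw [hf x hx hx', div_self this]
  ring

theorem of_apply_eq_self (h : ∀ x : I, c ≤ x → (x : ℝ) < d → f x = x) :
    MapsAffinely f c d c d := by
  intro x hx hx'
  have : d - c ≠ 0 := by linarith
  rw [h x hx hx', div_self this]
  ring

theorem isDirectAffineOnIco (hf : MapsAffinely f c d c' d') (hcd : c < d) (h' : c' < d') :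
    IsDirectAffineOnIco f c d := by
  refine ⟨(d' - c') / (d - c), c' - (d' - c') / (d - c) * c,
    div_pos (by linarith) (by linarith), fun x hx hx' => ?_⟩
  rw [hf x hx hx']
  ring

end MapsAffinely

theorem IsDirectAffineOnIco.exists_mapsAffinely {f : Equiv.Perm I} {c d : ℝ} (hc : 0 ≤ c)
    (hcd : c < d) (hd : d ≤ 1) (h : IsDirectAffineOnIco f c d) :
    ∃ c' d', 0 ≤ c' ∧ c' < d' ∧ d' ≤ 1 ∧ MapsAffinely f c d c' d' := by
  obtain ⟨l, b, hl, h⟩ := h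
  obtain ⟨⟨h1, -⟩, -, h4⟩ := affine_endpoints_perm hc hcd hd fun x hx hx' => h x hx.le hx'
  refine ⟨l * c + b, l * d + b, h1, by nlinarith, h4, fun x hx hx' => ?_⟩
  have : d - c ≠ 0 := by linarith
  rw [h x hx hx']
  field_simp
  ring

/-- A bijection which is affine on the pieces of a finite cover by half-open intervals is an affine
interval exchange transformation. -/
theorem isAIET_of_cover {ι : Type*} [Finite ι] {f : Equiv.Perm I} (c d : ι → ℝ)
    (hcov : ∀ x : I, ∃ i, c i ≤ x ∧ (x : ℝ) < d i)
    (h : ∀ i, IsDirectAffineOnIco f (c i) (d i)) : IsAIET f := by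
  classical
  have := Fintype.ofFinite ι
  rw [isAIET_iff]
  -- Right endpoints suffice as breaks: if the piece containing `u` does not end strictly between
  -- `u` and `v`, it contains all of `[u,v)`.
  refine ⟨Finset.univ.image d, fun u v hu huv hv hD => ?_⟩
  obtain ⟨i, hi, hi'⟩ := hcov ⟨u, hu, by linarith⟩
  obtain ⟨l, b, hl, hlb⟩ := h i
  refine ⟨l, b, hl, fun x hx hx' => hlb x (hi.trans hx) ?_⟩
  by_contra hcon
  exact hD (d i) (Finset.mem_image_of_mem _ (Finset.mem_univ _)) ⟨hi', by linarith⟩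

/-! ### Supports -/

/-- The bijections which are the identity off `[p,q)`. -/
def fixingOff (p q : ℝ) : Subgroup (Equiv.Perm I) where
  carrier := {f | ∀ x : I, ((x : ℝ) < p ∨ q ≤ x) → f x = x}
  one_mem' := fun _ _ => rfl
  mul_mem' := fun {f g} hf hg x hx => by rw [Equiv.Perm.mul_apply, hg x hx, hf x hx]
  inv_mem' := fun {f} hf x hx => by rw [Equiv.Perm.inv_eq_iff_eq, hf x hx]

theorem fixingOff_mono {p q p' q' : ℝ} (hp : p' ≤ p) (hq : q ≤ q') :
    fixingOff p q ≤ fixingOff p' q' :=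
  fun _ hf x hx => hf x (hx.imp (fun h => h.trans_le hp) fun h => hq.trans h)

/-- If `f x` left `[p,q)`, it would be a fixed point of `f`, and injectivity would give `f x = x`.
-/
theorem mapsTo_of_mem_fixingOff {p q : ℝ} {f : Equiv.Perm I} (hf : f ∈ fixingOff p q) {x : I}
    (hx : p ≤ x) (hx' : (x : ℝ) < q) : p ≤ f x ∧ (f x : ℝ) < q := by
  by_contra hcon
  have h1 : (f x : ℝ) < p ∨ q ≤ f x := by
    by_contra h2
    push Not at h2
    exact hcon h2
  have h2 := f.injective (hf (f x) h1)
  rw [h2] at h1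
  rcases h1 with h | h <;> linarith

theorem conj_mem_fixingOff {t y : Equiv.Perm I} {p q p' q' : ℝ} (ht : MapsAffinely t p q p' q')
    (h' : p' < q') (hy : y ∈ fixingOff p q) : t * y * t⁻¹ ∈ fixingOff p' q' := by
  intro x hx
  rw [Equiv.Perm.mul_apply, Equiv.Perm.mul_apply, hy, perm_apply_inv]
  by_contra hcon
  push Not at hcon
  have := ht.mem h' hcon.1 hcon.2
  rw [perm_apply_inv] at this
  rcases hx with h | h <;> linarith

theorem commute_of_mem_fixingOff {p q r s : ℝ} (hqr : q ≤ r) {x y : Equiv.Perm I}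
    (hx : x ∈ fixingOff p q) (hy : y ∈ fixingOff r s) : Commute x y := by
  apply Equiv.Perm.Disjoint.commute
  intro z
  rcases lt_or_ge (z : ℝ) q with h | h
  · exact Or.inr (hy z (Or.inl (by linarith)))
  · exact Or.inl (hx z (Or.inr h))

/-! ### Piecewise linear maps with one interior break -/

/-- The function `[0,1) → [0,1)` taking `[0,b)` to `[0,b')` and `[b,1)` to `[b',1)` affinely. -/
noncomputable def stretchFun (b b' : Set.Ioo (0 : ℝ) 1) (x : I) : I :=
  ⟨if (x : ℝ) < b then b' / b * x else 1 - (1 - b') / (1 - b) * (1 - x), by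
    obtain ⟨b, hb, hb1⟩ := b
    obtain ⟨b', hb', hb1'⟩ := b'
    obtain ⟨x, hx, hx1⟩ := x
    simp only
    split_ifs with h
    · have : b' / b * x < b' := by
        rw [div_mul_eq_mul_div, div_lt_iff₀ hb]; nlinarith
      exact ⟨by positivity, by linarith⟩
    · have h1 : (1 - b') / (1 - b) * (1 - x) ≤ 1 - b' := by
        rw [div_mul_eq_mul_div, div_le_iff₀ (by linarith)]; nlinarith
      have h2 : 0 < (1 - b') / (1 - b) * (1 - x) :=
        mul_pos (div_pos (by linarith) (by linarith)) (by linarith)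
      exact ⟨by linarith, by linarith⟩⟩

theorem stretchFun_stretchFun (b b' : Set.Ioo (0 : ℝ) 1) (x : I) :
    stretchFun b' b (stretchFun b b' x) = x := by
  obtain ⟨b, hb, hb1⟩ := b
  obtain ⟨b', hb', hb1'⟩ := b'
  obtain ⟨x, hx, hx1⟩ := x
  apply Subtype.ext
  have h0 : 0 < 1 - b := by linarith
  have h0' : 0 < 1 - b' := by linarith
  simp only [stretchFun]
  by_cases h : x < b
  · have : b' / b * x < b' := by
      rw [div_mul_eq_mul_div, div_lt_iff₀ hb]; nlinarith
    rw [if_pos h, if_pos this]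
    field_simp
  · have h1 : (1 - b') / (1 - b) * (1 - x) ≤ 1 - b' := by
      rw [div_mul_eq_mul_div, div_le_iff₀ (by linarith)]; nlinarith
    rw [if_neg h, if_neg (by linarith)]
    field_simp
    ring

/-- The piecewise linear bijection of `[0,1)` taking `[0,b)` to `[0,b')` and `[b,1)` to
`[b',1)`. -/
noncomputable def stretch (b b' : Set.Ioo (0 : ℝ) 1) : Equiv.Perm I where
  toFun := stretchFun b b'
  invFun := stretchFun b' b
  left_inv := stretchFun_stretchFun b b'
  right_inv := stretchFun_stretchFun b' b

theorem stretch_inv (b b' : Set.Ioo (0 : ℝ) 1) : (stretch b b')⁻¹ = stretch b' b := rfl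

theorem stretch_left (b b' : Set.Ioo (0 : ℝ) 1) : MapsAffinely (stretch b b') 0 b 0 b' := by
  intro x hx hx'
  change (stretchFun b b' x : ℝ) = _
  simp only [stretchFun, if_pos hx']
  ring

theorem stretch_right (b b' : Set.Ioo (0 : ℝ) 1) : MapsAffinely (stretch b b') b 1 b' 1 := by
  intro x hx hx'
  change (stretchFun b b' x : ℝ) = _
  have : (1 : ℝ) - b ≠ 0 := by linarith [b.2.2]
  simp only [stretchFun, if_neg (not_lt.2 hx)]
  field_simp
  ring

/-- A bijection made of two increasing affine pieces. -/
theorem isAIET_of_two {f : Equiv.Perm I} {b c d c' d' : ℝ} (hb : 0 < b ∧ b < 1) (hcd : c < d)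
    (hcd' : c' < d') (h1 : MapsAffinely f 0 b c d) (h2 : MapsAffinely f b 1 c' d') : IsAIET f := by
  refine isAIET_of_cover (ι := Bool) (fun i => cond i 0 b) (fun i => cond i b 1) ?_ ?_
  · intro x
    rcases lt_or_ge (x : ℝ) b with h | h
    · exact ⟨true, x.2.1, h⟩
    · exact ⟨false, h, x.2.2⟩
  · rintro (_ | _)
    · exact h2.isDirectAffineOnIco hb.2 hcd'
    · exact h1.isDirectAffineOnIco hb.1 hcd

theorem isAIET_stretch (b b' : Set.Ioo (0 : ℝ) 1) : IsAIET (stretch b b') :=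
  isAIET_of_two b.2 b'.2.1 b'.2.2 (stretch_left b b') (stretch_right b b')

theorem strictMono_stretch (b b' : Set.Ioo (0 : ℝ) 1) : StrictMono (stretch b b') := by
  intro x y hxy
  have hxy : (x : ℝ) < y := hxy
  change (stretch b b' x : ℝ) < stretch b b' y
  rcases lt_or_ge (y : ℝ) b with hy | hy
  · rw [stretch_left b b' x x.2.1 (hxy.trans hy), stretch_left b b' y y.2.1 hy]
    have : 0 < ((b' : ℝ) - 0) / (b - 0) := div_pos (by linarith [b'.2.1]) (by linarith [b.2.1])
    nlinarith
  · rcases lt_or_ge (x : ℝ) b with hx | hx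
    · exact ((stretch_left b b').mem b'.2.1 x.2.1 hx).2.trans_le
        ((stretch_right b b').mem b'.2.2 hy y.2.2).1
    · rw [stretch_right b b' x hx x.2.2, stretch_right b b' y hy y.2.2]
      have : 0 < (1 - (b' : ℝ)) / (1 - b) :=
        div_pos (by linarith [b'.2.2]) (by linarith [b.2.2])
      nlinarith

/-! ### Rescaling a bijection to a subinterval -/

/-- `[a,c)` is a nonempty subinterval of `[0,1)`. -/
def IsSub (a c : ℝ) : Prop := 0 ≤ a ∧ a < c ∧ c ≤ 1

/-- The increasing affine bijection from `[0,1)` to `[a,c)`. -/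
noncomputable def affineEquiv {a c : ℝ} (h : IsSub a c) : I ≃ {x : I // a ≤ x ∧ (x : ℝ) < c} where
  toFun y := ⟨⟨a + (c - a) * y, by
    obtain ⟨h1, h2, h3⟩ := h
    obtain ⟨y, hy, hy1⟩ := y
    constructor <;> simp only <;> nlinarith⟩, by
    obtain ⟨h1, h2, h3⟩ := h
    obtain ⟨y, hy, hy1⟩ := y
    constructor <;> simp only <;> nlinarith⟩
  invFun x := ⟨(x - a) / (c - a), by
    have := x.2
    have h2 := h.2.1
    exact ⟨div_nonneg (by linarith) (by linarith), by
      rw [div_lt_one (by linarith)]; linarith⟩⟩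
  left_inv y := by
    have := h.2.1
    have h2 : c - a ≠ 0 := by linarith
    apply Subtype.ext
    simp only
    field_simp
    ring
  right_inv x := by
    have := h.2.1
    have h2 : c - a ≠ 0 := by linarith
    apply Subtype.ext
    apply Subtype.ext
    simp only
    field_simp
    ring

/-- The point of `[a,c)` with normalized coordinate `y`. -/
noncomputable def affinePoint {a c : ℝ} (h : IsSub a c) (y : I) : I := affineEquiv h y

theorem coe_affinePoint {a c : ℝ} (h : IsSub a c) (y : I) :
    (affinePoint h y : ℝ) = a + (c - a) * y := rfl

theorem exists_affinePoint {a c : ℝ} (h : IsSub a c) {x : I} (hx : a ≤ x) (hx' : (x : ℝ) < c) :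
    ∃ y, affinePoint h y = x :=
  ⟨(affineEquiv h).symm ⟨x, hx, hx'⟩, by simp [affinePoint]⟩

theorem affinePoint_mem {a c : ℝ} (h : IsSub a c) (y : I) :
    a ≤ affinePoint h y ∧ (affinePoint h y : ℝ) < c := (affineEquiv h y).2

theorem affinePoint_injective {a c : ℝ} (h : IsSub a c) : Function.Injective (affinePoint h) :=
  Subtype.val_injective.comp (affineEquiv h).injective

/-- The bijection `u` of `[0,1)`, rescaled to `[a,c)` and extended by the identity. -/
noncomputable def scale {a c : ℝ} (h : IsSub a c) : Equiv.Perm I →* Equiv.Perm I :=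
  Equiv.Perm.extendDomainHom (affineEquiv h)

variable {a c a' c' : ℝ} (h : IsSub a c) (h' : IsSub a' c')

theorem scale_affinePoint (u : Equiv.Perm I) (y : I) :
    scale h u (affinePoint h y) = affinePoint h (u y) :=
  Equiv.Perm.extendDomain_apply_image u (affineEquiv h) y

theorem scale_mem_fixingOff (u : Equiv.Perm I) : scale h u ∈ fixingOff a c := by
  intro x hx
  refine Equiv.Perm.extendDomain_apply_not_subtype u (affineEquiv h) ?_
  rintro ⟨h1, h2⟩
  rcases hx with h | h <;> linarith

theorem mapsAffinely_affinePoint {f : Equiv.Perm I} (hf : MapsAffinely f a c a' c') (y : I) :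
    f (affinePoint h y) = affinePoint h' y := by
  apply Subtype.ext
  have := h.2.1
  have h2 : c - a ≠ 0 := by linarith
  rw [hf _ (affinePoint_mem h y).1 (affinePoint_mem h y).2, coe_affinePoint, coe_affinePoint]
  field_simp
  ring

theorem MapsAffinely.scale {u : Equiv.Perm I} {s t s' t' : ℝ} (hu : MapsAffinely u s t s' t')
    (hs : 0 ≤ s) (hst : s < t) (ht : t ≤ 1) :
    MapsAffinely (scale h u) (a + (c - a) * s) (a + (c - a) * t) (a + (c - a) * s')
      (a + (c - a) * t') := by
  intro x hx hx'
  obtain ⟨h1, h2, h3⟩ := id h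
  obtain ⟨y, rfl⟩ := exists_affinePoint h (x := x) (by nlinarith) (by nlinarith)
  rw [coe_affinePoint] at hx hx'
  rw [scale_affinePoint, coe_affinePoint, coe_affinePoint, hu y (by nlinarith) (by nlinarith)]
  have h4 : c - a ≠ 0 := by linarith
  have h5 : t - s ≠ 0 := by linarith
  have h6 : a + (c - a) * t - (a + (c - a) * s) ≠ 0 := by
    have : a + (c - a) * t - (a + (c - a) * s) = (c - a) * (t - s) := by ring
    rw [this]
    exact mul_ne_zero h4 h5
  field_simp
  ring

/-- Conjugating a rescaled bijection by an affine map. -/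
theorem conj_scale {g : Equiv.Perm I} (hg : MapsAffinely g a c a' c') (u : Equiv.Perm I) :
    g * scale h u * g⁻¹ = scale h' u := by
  rw [mul_inv_eq_iff_eq_mul]
  ext x : 1
  rw [Equiv.Perm.mul_apply, Equiv.Perm.mul_apply]
  by_cases hx : a ≤ x ∧ (x : ℝ) < c
  · obtain ⟨y, rfl⟩ := exists_affinePoint h hx.1 hx.2
    rw [scale_affinePoint, mapsAffinely_affinePoint h h' hg, mapsAffinely_affinePoint h h' hg,
      scale_affinePoint]
  · have hx1 : (x : ℝ) < a ∨ c ≤ x := by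
      by_contra hcon
      push Not at hcon
      exact hx hcon
    rw [scale_mem_fixingOff h u x hx1, scale_mem_fixingOff h' u]
    by_contra hcon
    push Not at hcon
    obtain ⟨y, hy⟩ := exists_affinePoint h' hcon.1 hcon.2
    rw [← mapsAffinely_affinePoint h h' hg] at hy
    rw [← g.injective hy] at hx
    exact hx (affinePoint_mem h y)

theorem scale_scale {s t : ℝ} (h1 : IsSub s t) (h2 : IsSub a' c')
    (ha : a' = a + (c - a) * s) (hc : c' = a + (c - a) * t) (u : Equiv.Perm I) :
    scale h (scale h1 u) = scale h2 u := by
  have hpt : ∀ z, affinePoint h (affinePoint h1 z) = affinePoint h2 z := by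
    intro z
    apply Subtype.ext
    rw [coe_affinePoint, coe_affinePoint, coe_affinePoint, ha, hc]
    ring
  obtain ⟨-, h3, -⟩ := id h
  ext x : 1
  by_cases hx : a ≤ x ∧ (x : ℝ) < c
  · obtain ⟨y, rfl⟩ := exists_affinePoint h hx.1 hx.2
    rw [scale_affinePoint]
    by_cases hy : s ≤ y ∧ (y : ℝ) < t
    · obtain ⟨z, rfl⟩ := exists_affinePoint h1 hy.1 hy.2
      rw [scale_affinePoint, hpt, hpt, scale_affinePoint]
    · have hy1 : (y : ℝ) < s ∨ t ≤ y := by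
        by_contra hcon
        push Not at hcon
        exact hy hcon
      rw [scale_mem_fixingOff h1 u y hy1, scale_mem_fixingOff h2 u]
      rw [coe_affinePoint]
      rcases hy1 with h | h
      · left; nlinarith
      · right; nlinarith
  · have hx1 : (x : ℝ) < a ∨ c ≤ x := by
      by_contra hcon
      push Not at hcon
      exact hx hcon
    obtain ⟨h4, h5, h6⟩ := h1
    rw [scale_mem_fixingOff h _ x hx1, scale_mem_fixingOff h2 u]
    rcases hx1 with h | h
    · left; nlinarith
    · right; nlinarith

theorem scale_strictMono {u : Equiv.Perm I} (hu : StrictMono u) : StrictMono (scale h u) := by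
  obtain ⟨-, h1, -⟩ := id h
  have hmaps : ∀ x : I, a ≤ x → (x : ℝ) < c → a ≤ scale h u x ∧ (scale h u x : ℝ) < c :=
    fun x => mapsTo_of_mem_fixingOff (scale_mem_fixingOff h u)
  have hoff : ∀ x : I, ((x : ℝ) < a ∨ c ≤ x) → scale h u x = x := scale_mem_fixingOff h u
  intro x y hxy
  have hxy : (x : ℝ) < y := hxy
  change (scale h u x : ℝ) < scale h u y
  by_cases hx : a ≤ x ∧ (x : ℝ) < c
  · by_cases hy : (y : ℝ) < c
    · obtain ⟨z, rfl⟩ := exists_affinePoint h hx.1 hx.2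
      obtain ⟨w, rfl⟩ := exists_affinePoint h (hx.1.trans hxy.le) hy
      rw [scale_affinePoint, scale_affinePoint]
      rw [coe_affinePoint, coe_affinePoint] at hxy ⊢
      have hzw : z < w := show (z : ℝ) < w by nlinarith
      have : (u z : ℝ) < u w := hu hzw
      nlinarith
    · push Not at hy
      rw [hoff y (Or.inr hy)]
      exact (hmaps x hx.1 hx.2).2.trans_le hy
  · have hx1 : (x : ℝ) < a ∨ c ≤ x := by
      by_contra hcon
      push Not at hcon
      exact hx hcon
    rw [hoff x hx1]
    by_cases hy : a ≤ y ∧ (y : ℝ) < c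
    · rcases hx1 with h | h
      · exact h.trans_le (hmaps y hy.1 hy.2).1
      · linarith
    · rw [hoff y]
      · exact hxy
      · by_contra hcon
        push Not at hcon
        exact hy hcon

theorem isAIET_scale {u : Equiv.Perm I} (hu : IsAIET u) : IsAIET (scale h u) := by
  obtain ⟨p, b, hb, hb0, hb1, hP⟩ := hu
  obtain ⟨h1, h2, h3⟩ := id h
  have hb01 : ∀ j, 0 ≤ b j ∧ b j ≤ 1 := fun j =>
    ⟨by rw [← hb0]; exact hb.monotone (Fin.zero_le _),
      by rw [← hb1]; exact hb.monotone (Fin.le_last _)⟩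
  -- The two extra pieces `[0,a)` and `[c,1)` may be empty, which a cover permits and a subdivision
  -- does not.
  refine isAIET_of_cover (ι := Fin p ⊕ Bool)
    (Sum.elim (fun i => a + (c - a) * b i.castSucc) fun i => cond i 0 c)
    (Sum.elim (fun i => a + (c - a) * b i.succ) fun i => cond i a 1) ?_ ?_
  · intro x
    by_cases hx : a ≤ x ∧ (x : ℝ) < c
    · obtain ⟨y, rfl⟩ := exists_affinePoint h hx.1 hx.2
      obtain ⟨i, hi, hi'⟩ := exists_piece hb0 hb1 y.2.1 y.2.2
      refine ⟨Sum.inl i, ?_, ?_⟩ <;> simp only [Sum.elim_inl, coe_affinePoint] <;> nlinarith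
    · rcases lt_or_ge (x : ℝ) a with hxa | hxa
      · exact ⟨Sum.inr true, x.2.1, hxa⟩
      · exact ⟨Sum.inr false, not_lt.1 fun hc => hx ⟨hxa, hc⟩, x.2.2⟩
  · rintro (i | _ | _)
    · have hlt : b i.castSucc < b i.succ := hb Fin.castSucc_lt_succ
      obtain ⟨u', v', -, huv, -, hm⟩ :=
        (hP i).exists_mapsAffinely (hb01 _).1 hlt (hb01 _).2
      have := hm.scale h (hb01 _).1 hlt (hb01 _).2
      exact this.isDirectAffineOnIco (by nlinarith) (by nlinarith)
    · exact ⟨1, 0, one_pos, fun x hx _ => by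
        rw [scale_mem_fixingOff h u x (Or.inr hx)]; ring⟩
    · exact ⟨1, 0, one_pos, fun x _ hx => by
        rw [scale_mem_fixingOff h u x (Or.inl hx)]; ring⟩

end IntervalExchange

namespace IntervalExchange

/-! ### The group of the circle, read on `[0,1)` -/

theorem circleEquivI_coe (x : ℝ) : (circleEquivI (x : UnitAddCircle) : ℝ) = Int.fract x := by
  simp [circleEquivI]

theorem circleEquivI_symm (x : I) : circleEquivI.symm x = ((x : ℝ) : UnitAddCircle) := by
  rw [Equiv.symm_apply_eq]
  apply Subtype.ext
  rw [circleEquivI_coe, Int.fract_eq_self.2 ⟨x.2.1, x.2.2⟩]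

theorem readOnI_apply (h : UnitAddCircle ≃ₜ UnitAddCircle) (x : I) :
    readOnI h x = circleEquivI (h ((x : ℝ) : UnitAddCircle)) := by
  rw [← circleEquivI_symm]
  rfl

theorem readOnI_injective : Function.Injective readOnI := fun _ _ h =>
  Homeomorph.toEquiv_injective (circleEquivI.permCongr.injective h)

/-- The rotation `x ↦ x + α mod 1` of `[0,1)`. -/
noncomputable def rot (α : ℝ) : Equiv.Perm I :=
  readOnI (Homeomorph.addLeft (α : UnitAddCircle))

theorem rot_apply (α : ℝ) (x : I) : (rot α x : ℝ) = Int.fract (α + x) := by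
  rw [rot, readOnI_apply, ← circleEquivI_coe]
  rfl

theorem rot_left {α : ℝ} (h0 : 0 < α) (h1 : α < 1) : MapsAffinely (rot α) 0 (1 - α) α 1 := by
  intro x hx hx'
  rw [rot_apply, Int.fract_eq_self.2 ⟨by linarith, by linarith⟩]
  have : 1 - α ≠ 0 := by linarith
  field_simp
  ring

theorem rot_right {α : ℝ} (h0 : 0 < α) (h1 : α < 1) : MapsAffinely (rot α) (1 - α) 1 0 α := by
  intro x hx hx'
  have : Int.fract (α + x) = α + x - 1 := by
    rw [Int.fract_eq_iff]
    exact ⟨by linarith, by linarith, 1, by push_cast; ring⟩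
  have e : (1 : ℝ) - (1 - α) = α := by ring
  rw [rot_apply, this, e, sub_zero, div_self (by linarith)]
  ring

theorem isAIET_rot {α : ℝ} (h0 : 0 < α) (h1 : α < 1) : IsAIET (rot α) :=
  isAIET_of_two ⟨by linarith, by linarith⟩ h1 h0 (rot_left h0 h1) (rot_right h0 h1)

/-- The image of `PL⁺(𝕊¹)` in the bijections of `[0,1)`. -/
noncomputable def CirclePL : Subgroup (Equiv.Perm I) := PLPlusCircle.map readOnI

theorem circlePL_le : CirclePL ≤ AffinePlus := by
  rintro _ ⟨h, hh, rfl⟩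
  exact hh

theorem rot_mem_circlePL {α : ℝ} (h0 : 0 < α) (h1 : α < 1) : rot α ∈ CirclePL :=
  ⟨_, isAIET_rot h0 h1, rfl⟩

/-- The lift to the line of a bijection of `[0,1)`. -/
noncomputable def lift (f : Equiv.Perm I) (x : ℝ) : ℝ :=
  ⌊x⌋ + f ⟨Int.fract x, Int.fract_nonneg x, Int.fract_lt_one x⟩

/-- A monotone surjection of the line is continuous. Monotonicity across integers holds because `f`
takes values in `[0,1)`, and surjectivity because `f` is a bijection. -/
theorem continuous_lift {f : Equiv.Perm I} (hf : StrictMono f) : Continuous (lift f) := by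
  apply Monotone.continuous_of_surjective
  · intro x y hxy
    have hfx := (f ⟨Int.fract x, Int.fract_nonneg x, Int.fract_lt_one x⟩).2
    have hfy := (f ⟨Int.fract y, Int.fract_nonneg y, Int.fract_lt_one y⟩).2
    rcases (Int.floor_mono hxy).lt_or_eq with h | h
    · have : (⌊x⌋ : ℝ) + 1 ≤ ⌊y⌋ := by exact_mod_cast h
      have h1 := hfx.2
      have h2 := hfy.1
      simp only [lift]
      linarith
    · have h1 : Int.fract x ≤ Int.fract y := by rw [Int.fract, Int.fract, h]; linarith
      have h2 : (f ⟨Int.fract x, Int.fract_nonneg x, Int.fract_lt_one x⟩ : ℝ) ≤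
        f ⟨Int.fract y, Int.fract_nonneg y, Int.fract_lt_one y⟩ := hf.monotone h1
      simp only [lift, h]
      linarith
  · intro y
    have hg := (f⁻¹ ⟨Int.fract y, Int.fract_nonneg y, Int.fract_lt_one y⟩).2
    have hfl : ⌊(⌊y⌋ : ℝ) + f⁻¹ ⟨Int.fract y, Int.fract_nonneg y, Int.fract_lt_one y⟩⌋ = ⌊y⌋ := by
      rw [Int.floor_intCast_add, Int.floor_eq_zero_iff.2 hg, add_zero]
    have hfr : Int.fract ((⌊y⌋ : ℝ) +
        f⁻¹ ⟨Int.fract y, Int.fract_nonneg y, Int.fract_lt_one y⟩) =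
        f⁻¹ ⟨Int.fract y, Int.fract_nonneg y, Int.fract_lt_one y⟩ := by
      rw [Int.fract_intCast_add, Int.fract_eq_self.2 hg]
    refine ⟨⌊y⌋ + f⁻¹ ⟨Int.fract y, Int.fract_nonneg y, Int.fract_lt_one y⟩, ?_⟩
    simp only [lift, hfl, hfr, Subtype.coe_eta, perm_apply_inv]
    exact Int.floor_add_fract y

theorem continuous_circle_of_strictMono {f : Equiv.Perm I} (hf : StrictMono f) :
    Continuous (circleEquivI.symm.permCongr f) := by
  rw [(QuotientAddGroup.isQuotientMap_mk (N := AddSubgroup.zmultiples (1 : ℝ))).continuous_iff]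
  have : (circleEquivI.symm.permCongr f) ∘ (QuotientAddGroup.mk : ℝ → UnitAddCircle) =
      (fun x : ℝ => (x : UnitAddCircle)) ∘ lift f := by
    ext x : 1
    have h1 : circleEquivI (x : UnitAddCircle) =
        ⟨Int.fract x, Int.fract_nonneg x, Int.fract_lt_one x⟩ :=
      Subtype.ext (circleEquivI_coe x)
    change circleEquivI.symm (f (circleEquivI (x : UnitAddCircle))) =
      ((lift f x : ℝ) : UnitAddCircle)
    rw [h1, circleEquivI_symm, lift, AddCircle.coe_add]
    have h2 : (((⌊x⌋ : ℤ) : ℝ) : UnitAddCircle) = 0 := by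
      rw [AddCircle.coe_eq_zero_iff]
      exact ⟨⌊x⌋, by simp⟩
    rw [h2, zero_add]
  rw [this]
  exact (AddCircle.continuous_mk' (1 : ℝ)).comp (continuous_lift hf)

theorem strictMono_inv {f : Equiv.Perm I} (hf : StrictMono f) : StrictMono (f⁻¹ : Equiv.Perm I) := by
  intro x y hxy
  rw [← hf.lt_iff_lt, perm_apply_inv, perm_apply_inv]
  exact hxy

/-- Continuity comes for free: an increasing bijection of `[0,1)` and its inverse both have
continuous lifts to the line, and these descend to the circle. -/
theorem mem_circlePL_of_strictMono {f : Equiv.Perm I} (hf : StrictMono f) (hA : IsAIET f) :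
    f ∈ CirclePL := by
  have hr : ∀ h : UnitAddCircle ≃ₜ UnitAddCircle,
      h.toEquiv = circleEquivI.symm.permCongr f → readOnI h = f := by
    intro h hh
    change circleEquivI.permCongr h.toEquiv = f
    rw [hh]
    ext x
    simp [Equiv.permCongr_apply]
  let h : UnitAddCircle ≃ₜ UnitAddCircle :=
    { circleEquivI.symm.permCongr f with
      continuous_toFun := continuous_circle_of_strictMono hf
      continuous_invFun := continuous_circle_of_strictMono (f := f⁻¹) (strictMono_inv hf) }
  refine ⟨h, ?_, hr h rfl⟩
  change IsAIET (readOnI h)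
  rwa [hr h rfl]

/-- An element of the circle group that is the identity near `0` is increasing on `[0,1)`. -/
theorem strictMono_of_mem_circlePL {f : Equiv.Perm I} (hf : f ∈ CirclePL) {p q : ℝ} (hp : 0 < p)
    (hp1 : p ≤ 1) (hs : f ∈ fixingOff p q) : StrictMono f := by
  obtain ⟨h, -, rfl⟩ := hf
  have h0 : readOnI h ⟨0, by norm_num⟩ = ⟨0, by norm_num⟩ := hs _ (Or.inl hp)
  have hh0 : h 0 = 0 := by
    have := readOnI_apply h ⟨0, by norm_num⟩
    rw [h0, ← Equiv.symm_apply_eq, circleEquivI_symm] at this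
    simpa using this.symm
  -- The coordinate on the circle is discontinuous only at `0`. Since `h` fixes `0`, it never sends
  -- a point of `(0,1)` there.
  have hcont : ContinuousOn (fun x : ℝ => (circleEquivI (h (x : UnitAddCircle)) : ℝ))
      (Set.Ioo 0 1) := by
    intro x hx
    apply ContinuousAt.continuousWithinAt
    have hx0 : h (x : UnitAddCircle) ≠ ((0 : ℝ) : UnitAddCircle) := by
      rw [AddCircle.coe_zero, ← hh0, h.injective.ne_iff, Ne, AddCircle.coe_eq_zero_iff]
      rintro ⟨n, hn⟩
      simp only [zsmul_eq_mul, mul_one] at hn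
      rw [← hn] at hx
      have h1 : (0 : ℤ) < n := by exact_mod_cast hx.1
      have h2 : n < (1 : ℤ) := by exact_mod_cast hx.2
      omega
    have h1 := AddCircle.continuousAt_equivIco (p := (1 : ℝ)) (0 : ℝ) hx0
    have h2 : ContinuousAt (fun y : UnitAddCircle => (circleEquivI y : ℝ))
        (h (x : UnitAddCircle)) :=
      (continuous_subtype_val (p := fun y => y ∈ Set.Ico (0 : ℝ) (0 + 1))).continuousAt.comp h1
    exact ContinuousAt.comp (g := fun y : UnitAddCircle => (circleEquivI y : ℝ)) h2
      (h.continuous.comp (AddCircle.continuous_mk' (1 : ℝ))).continuousAt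
  have heq : ∀ x : I, (circleEquivI (h ((x : ℝ) : UnitAddCircle)) : ℝ) = readOnI h x := fun x => by
    rw [readOnI_apply]
  have hinj : Set.InjOn (fun x : ℝ => (circleEquivI (h (x : UnitAddCircle)) : ℝ))
      (Set.Ioo 0 1) := by
    intro x hx y hy hxy
    have h1 := heq ⟨x, hx.1.le, hx.2⟩
    have h2 := heq ⟨y, hy.1.le, hy.2⟩
    simp only at h1 h2 hxy
    rw [h1, h2] at hxy
    exact congrArg Subtype.val ((readOnI h).injective (Subtype.ext hxy))
  have hmono : StrictMonoOn (fun x : ℝ => (circleEquivI (h (x : UnitAddCircle)) : ℝ))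
      (Set.Ioo 0 1) := by
    rcases hcont.strictMonoOn_of_injOn_Ioo one_pos hinj with hm | hm
    · exact hm
    -- A continuous injection of `(0,1)` is strictly monotone; decreasing is excluded because the
    -- points `p / 3` and `p / 2` are fixed.
    · have h3 : p / 3 < p / 2 := by linarith
      have := hm (show p / 3 ∈ Set.Ioo (0 : ℝ) 1 by constructor <;> linarith)
        (show p / 2 ∈ Set.Ioo (0 : ℝ) 1 by constructor <;> linarith) h3
      have h1 := heq ⟨p / 3, by constructor <;> linarith⟩
      have h2 := heq ⟨p / 2, by constructor <;> linarith⟩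
      rw [hs _ (Or.inl (show p / 3 < p by linarith))] at h1
      rw [hs _ (Or.inl (show p / 2 < p by linarith))] at h2
      simp only at h1 h2 this
      rw [h1, h2] at this
      linarith
  intro x y hxy
  have hxy : (x : ℝ) < y := hxy
  change (readOnI h x : ℝ) < readOnI h y
  rcases x.2.1.eq_or_lt with hx | hx
  · have hx' : x = ⟨0, by norm_num⟩ := Subtype.ext hx.symm
    rw [hx', h0]
    refine lt_of_le_of_ne (readOnI h y).2.1 fun hne => ?_
    have : readOnI h y = readOnI h x := by
      rw [hx', h0]
      exact Subtype.ext hne.symm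
    rw [(readOnI h).injective this] at hxy
    exact lt_irrefl _ hxy
  · rw [← heq, ← heq]
    exact hmono ⟨hx, x.2.2⟩ ⟨hx.trans hxy, y.2.2⟩ hxy

end IntervalExchange

namespace IntervalExchange

/-! ### Generation by two-piece maps -/

/-- Two-piece maps of `[a,c)` with prescribed breaks, in absolute instead of normalized coordinates.
-/
theorem exists_stretch {a b b' c : ℝ} (h : IsSub a c) (hb : a < b ∧ b < c) (hb' : a < b' ∧ b' < c) :
    ∃ β β', MapsAffinely (scale h (stretch β β')) a b a b' ∧
      MapsAffinely (scale h (stretch β β')) b c b' c := by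
  have hac : 0 < c - a := by linarith
  have hr : ∀ t, a < t ∧ t < c → (t - a) / (c - a) ∈ Set.Ioo (0 : ℝ) 1 := fun t ht =>
    ⟨div_pos (by linarith) hac, by rw [div_lt_one hac]; linarith⟩
  have e : ∀ t, a + (c - a) * ((t - a) / (c - a)) = t := fun t => by field_simp; ring
  refine ⟨⟨_, hr b hb⟩, ⟨_, hr b' hb'⟩, ?_, ?_⟩
  · have := (stretch_left ⟨_, hr b hb⟩ ⟨_, hr b' hb'⟩).scale h le_rfl (hr b hb).1 (hr b hb).2.le
    simpa only [e, mul_zero, add_zero] using this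
  · have := (stretch_right ⟨_, hr b hb⟩ ⟨_, hr b' hb'⟩).scale h (hr b hb).1.le (hr b hb).2 le_rfl
    simpa only [e, mul_one, add_sub_cancel] using this

/-- Since `y` permutes `[p,q)`, the image of this single affine piece is all of `[p,q)`. This forces
`y` to be the identity, the base case of the induction on breaks. -/
theorem eq_endpoints_of_mem_fixingOff {y : Equiv.Perm I} {p q c d : ℝ} (hp : 0 ≤ p) (hpq : p < q)
    (hq : q ≤ 1) (hy : y ∈ fixingOff p q) (hcd : c < d) (h : MapsAffinely y p q c d) :
    c = p ∧ d = q := by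
  have hpt : ∀ z : I, p ≤ z → (z : ℝ) < q → c ≤ z ∧ (z : ℝ) < d := fun z hz hz' => by
    have h1 := mapsTo_of_mem_fixingOff (inv_mem hy) hz hz'
    have := h.mem hcd h1.1 h1.2
    rwa [perm_apply_inv] at this
  have hP := hpt ⟨p, hp, by linarith⟩ le_rfl hpq
  have hc : (y ⟨p, hp, by linarith⟩ : ℝ) = c := by
    rw [h _ le_rfl hpq]; simp
  have hc1 := (mapsTo_of_mem_fixingOff hy (x := ⟨p, hp, by linarith⟩) le_rfl hpq).1
  rw [hc] at hc1
  have hcp : c = p := le_antisymm hP.1 hc1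
  refine ⟨hcp, le_antisymm ?_ ?_⟩
  · by_contra hlt
    push Not at hlt
    have hqd : p < q ∧ q < d := ⟨hpq, hlt⟩
    have hm := h.inv hpq hcd hp hq
    have hz1 : p + (q - p) / (d - c) * (q - c) < q := by
      have h1 : 0 < d - c := by linarith
      have : (q - p) / (d - c) * (q - c) < q - p := by
        rw [div_mul_eq_mul_div, div_lt_iff₀ h1]
        nlinarith
      linarith
    have hz0 : p ≤ p + (q - p) / (d - c) * (q - c) := by
      have : 0 ≤ (q - p) / (d - c) * (q - c) :=
        mul_nonneg (div_nonneg (by linarith) (by linarith)) (by linarith)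
      linarith
    have h2 := h ⟨p + (q - p) / (d - c) * (q - c), by constructor <;> linarith⟩ hz0 hz1
    have h3 := (mapsTo_of_mem_fixingOff hy
      (x := ⟨p + (q - p) / (d - c) * (q - c), by constructor <;> linarith⟩) hz0 hz1).2
    rw [h2] at h3
    have h4 : d - c ≠ 0 := by linarith
    have h5 : q - p ≠ 0 := by linarith
    have : c + (d - c) / (q - p) * (p + (q - p) / (d - c) * (q - c) - p) = q := by
      field_simp
      ring
    linarith
  · by_contra hlt
    push Not at hlt
    have := (hpt ⟨d, by constructor <;> linarith⟩ (by simp only; linarith) hlt).2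
    exact lt_irrefl _ this

/-- A bijection exchanging `[p,x)` and `[x,y)` by translations, trivial if `x = p`. -/
theorem exists_exchange {K : Subgroup (Equiv.Perm I)} {p x y : ℝ} (h : IsSub p y) (hpx : p ≤ x)
    (hxy : x < y) (hK : x = p ∨ ∀ α, 0 < α → α < 1 → scale h (rot α) ∈ K) :
    ∃ r ∈ K, r ∈ fixingOff p y ∧ MapsAffinely r x y p (p + y - x) ∧ (x = p → r = 1) ∧
      (p < x → MapsAffinely r p x (p + y - x) y) := by
  rcases hpx.eq_or_lt with rfl | hlt
  · refine ⟨1, K.one_mem, Subgroup.one_mem _, ?_, fun _ => rfl, fun h => absurd h (lt_irrefl _)⟩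
    have : p + y - p = y := by ring
    rw [this]
    exact MapsAffinely.of_apply_eq_self fun _ _ _ => rfl
  · have hy : 0 < y - p := by linarith
    -- In normalized coordinates on `[p,y)` the rotation angle `(y - x) / (y - p)` puts the
    -- discontinuity at `x`.
    have h0 : 0 < (y - x) / (y - p) := div_pos (by linarith) hy
    have h1 : (y - x) / (y - p) < 1 := by rw [div_lt_one hy]; linarith
    have e1 : p + (y - p) * (1 - (y - x) / (y - p)) = x := by field_simp; ring
    have e2 : p + (y - p) * ((y - x) / (y - p)) = p + y - x := by field_simp; ring
    refine ⟨scale h (rot ((y - x) / (y - p))), ?_, scale_mem_fixingOff _ _, ?_,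
      fun h => absurd h hlt.ne', fun _ => ?_⟩
    · rcases hK with hK | hK
      · exact absurd hK hlt.ne'
      · exact hK _ h0 h1
    · have := (rot_right h0 h1).scale h (by linarith) (by linarith) le_rfl
      simpa only [e1, e2, mul_one, mul_zero, add_zero, add_sub_cancel] using this
    · have := (rot_left h0 h1).scale h le_rfl (by linarith) (by linarith)
      simpa only [e1, e2, mul_one, mul_zero, add_zero, add_sub_cancel] using this

/-- A piecewise affine bijection supported in `[p,q)` lies in any group that contains the rescaled
two-piece continuous maps and, unless it is increasing, the rescaled rotations. -/
theorem mem_of_affine_pieces {K : Subgroup (Equiv.Perm I)} {p₀ q : ℝ} (hp₀ : 0 ≤ p₀) (hq : q ≤ 1)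
    (hE : ∀ {a : ℝ} (h : IsSub a q), p₀ ≤ a → ∀ b b', scale h (stretch b b') ∈ K) {mono : Prop}
    (hX : mono ∨ ∀ {a c : ℝ} (h : IsSub a c), p₀ ≤ a → c ≤ q →
      ∀ α, 0 < α → α < 1 → scale h (rot α) ∈ K) (n : ℕ) :
    ∀ p, p₀ ≤ p → p < q → ∀ y ∈ fixingOff p q, (mono → StrictMono y) →
      ∀ D : Finset ℝ, (∀ x ∈ D, p < x ∧ x < q) → D.card = n →
      (∀ c d, p ≤ c → c < d → d ≤ q → (∀ x ∈ D, ¬ (c < x ∧ x < d)) → IsDirectAffineOnIco y c d) →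
      y ∈ K := by
  induction n with
  | zero =>
    intro p hp hpq y hy _ D _ hcard haff
    rw [Finset.card_eq_zero] at hcard
    subst hcard
    obtain ⟨c, d, -, hcd, -, hm⟩ := (haff p q le_rfl hpq le_rfl (by simp)).exists_mapsAffinely
      (hp₀.trans hp) hpq hq
    obtain ⟨rfl, rfl⟩ := eq_endpoints_of_mem_fixingOff (hp₀.trans hp) hpq hq hy hcd hm
    have : y = 1 := by
      ext x : 1
      by_cases hx : c ≤ x ∧ (x : ℝ) < d
      · exact hm.apply_eq_self hx.1 hx.2
      · refine hy x ?_
        by_contra hcon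
        push Not at hcon
        exact hx hcon
    rw [this]
    exact K.one_mem
  | succ n ih =>
    intro p hp hpq y hy hmono D hD hcard haff
    have hp0 := hp₀.trans hp
    have hne : D.Nonempty := Finset.card_pos.1 (by omega)
    obtain ⟨b, hbD, hbmin⟩ : ∃ b ∈ D, ∀ x ∈ D, b ≤ x :=
      ⟨D.min' hne, D.min'_mem hne, fun x hx => D.min'_le x hx⟩
    obtain ⟨hpb, hbq⟩ := hD b hbD
    obtain ⟨x₁, y₁, -, hxy, hy1, hm⟩ := (haff p b le_rfl hpb hbq.le fun x hx h =>
      (hbmin x hx).not_gt h.2).exists_mapsAffinely hp0 hpb (by linarith)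
    have hyI : ∀ x : I, p ≤ x → (x : ℝ) < q → p ≤ y x ∧ (y x : ℝ) < q :=
      fun x => mapsTo_of_mem_fixingOff hy
    have hyp : (y ⟨p, hp0, by linarith⟩ : ℝ) = x₁ := by
      rw [hm _ le_rfl hpb]; simp
    have hpx : p ≤ x₁ := by
      rw [← hyp]; exact (hyI _ le_rfl hpq).1
    have hmi := hm.inv hpb hxy hp0 (by linarith)
    have hinv : ∀ z : I, x₁ ≤ z → (z : ℝ) < y₁ → p ≤ y⁻¹ z ∧ (y⁻¹ z : ℝ) < b :=
      fun z hz hz' => hmi.mem hpb hz hz'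
    have hyq : y₁ ≤ q := by
      by_contra hlt
      push Not at hlt
      rcases hq.eq_or_lt with rfl | hq1
      · linarith
      · have hx1q : x₁ < q := by rw [← hyp]; exact (hyI _ le_rfl hpq).2
        have h1 := hinv ⟨q, by linarith, hq1⟩ hx1q.le hlt
        have h2 := (hyI _ h1.1 (h1.2.trans hbq)).2
        rw [perm_apply_inv] at h2
        exact lt_irrefl _ h2
    have hsub : IsSub p y₁ := ⟨hp0, by linarith, by linarith⟩
    -- An increasing `y` preserves the left end of its support, so the exchange is trivial and no
    -- rotation is needed.
    have hxp : mono → x₁ = p := fun hmon => by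
      refine le_antisymm ?_ hpx
      have h1 := mapsTo_of_mem_fixingOff (inv_mem hy) (x := ⟨p, hp0, by linarith⟩) le_rfl hpq
      have h2 : (⟨p, hp0, by linarith⟩ : I) ≤ y⁻¹ ⟨p, hp0, by linarith⟩ := h1.1
      have h3 := (hmono hmon).monotone h2
      rw [perm_apply_inv] at h3
      rw [← hyp]
      exact h3
    obtain ⟨r, hrK, hr, hr1, hr2, hr3⟩ := exists_exchange (K := K) hsub hpx hxy
      (hX.imp hxp fun h => h hsub hp hyq)
    -- the image of any later piece avoids `[x₁,y₁)`
    have havoid : ∀ x : I, b ≤ x → (y x : ℝ) < x₁ ∨ y₁ ≤ y x := fun x hx => by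
      by_contra hcon
      push Not at hcon
      have := (hinv _ hcon.1 hcon.2).2
      rw [perm_inv_apply] at this
      linarith
    -- The image of `b` lies in `[p,q)` but outside `[x₁,y₁)`. Hence the first image does not fill
    -- `[p,q)`, and its translate to the left end leaves an interior break for the stretch.
    have hmq : p + y₁ - x₁ < q := by
      have h1 := hyI ⟨b, by linarith, by linarith⟩ hpb.le hbq
      rcases havoid ⟨b, by linarith, by linarith⟩ le_rfl with h | h
      · linarith
      · linarith
    have hsub' : IsSub p q := ⟨hp0, hpq, hq⟩
    obtain ⟨β, β', hE1, hE2⟩ := exists_stretch (b := p + y₁ - x₁) (b' := b) hsub'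
      ⟨by linarith, hmq⟩ ⟨hpb, hbq⟩
    have hEK := hE hsub' hp β β'
    have hEfix : scale hsub' (stretch β β') ∈ fixingOff p q := scale_mem_fixingOff _ _
    have hEmono := scale_strictMono hsub' (strictMono_stretch β β')
    generalize scale hsub' (stretch β β') = e at hE1 hE2 hEK hEfix hEmono
    have hrfix : r ∈ fixingOff p q := fixingOff_mono le_rfl hyq hr
    -- `r` slides the image of the first piece to the left end and `e` restores its length to `b -
    -- p`. The product is thus the identity on `[p,b)`, and it has lost the break `b`.
    have hz : e * r * y ∈ K := by
      refine ih b (hp.trans hpb.le) hbq _ ?_ ?_ (D.erase b) ?_ ?_ ?_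
      · rintro x hx
        by_cases hx' : p ≤ x ∧ (x : ℝ) < b
        · have h1 : MapsAffinely (e * r * y) p b p b :=
            (hE1.mul hr1 (by linarith)).mul hm hxy
          exact h1.apply_eq_self hx'.1 hx'.2
        · refine mul_mem (mul_mem hEfix hrfix) hy x ?_
          rcases hx with hx | hx
          · left
            by_contra hcon
            push Not at hcon
            exact hx' ⟨hcon, hx⟩
          · exact Or.inr hx
      · intro hmon
        rw [hr2 (hxp hmon), mul_one]
        exact hEmono.comp (hmono hmon)
      · intro x hx
        obtain ⟨hxb, hxD⟩ := Finset.mem_erase.1 hx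
        exact ⟨lt_of_le_of_ne (hbmin x hxD) (Ne.symm hxb), (hD x hxD).2⟩
      · rw [Finset.card_erase_of_mem hbD, hcard]; rfl
      · intro c d hbc hcd hdq hav
        have hc0 : 0 ≤ c := by linarith
        obtain ⟨c', d', hc', hcd', hd', hmc⟩ := (haff c d (by linarith) hcd hdq fun x hx hxx =>
          hav x (Finset.mem_erase.2 ⟨by rintro rfl; linarith [hxx.1], hx⟩)
            hxx).exists_mapsAffinely hc0 hcd (by linarith)
        have hyc : (y ⟨c, hc0, by linarith⟩ : ℝ) = c' := by
          rw [hmc _ le_rfl hcd]; simp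
        have hmci := hmc.inv hcd hcd' hc0 (by linarith)
        have hpc' : p ≤ c' := by
          rw [← hyc]; exact (hyI _ (by simp only; linarith) (by simp only; linarith)).1
        have hcq : c' < q := by
          rw [← hyc]; exact (hyI _ (by simp only; linarith) (by simp only; linarith)).2
        have himg : ∀ z : I, c' ≤ z → (z : ℝ) < d' → ((z : ℝ) < x₁ ∨ y₁ ≤ z) ∧ (z : ℝ) < q := by
          intro z hz hz'
          have h1 := hmci.mem hcd hz hz'
          have h2 := havoid (y⁻¹ z) (hbc.trans h1.1)
          have h3 := (hyI (y⁻¹ z) (by linarith) (by linarith)).2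
          rw [perm_apply_inv] at h2 h3
          exact ⟨h2, h3⟩
        have hd'q : d' ≤ q := by
          by_contra hlt
          push Not at hlt
          have := (himg ⟨q, by linarith, by linarith⟩ hcq.le hlt).2
          exact lt_irrefl _ this
        -- The image of a later piece is an interval disjoint from `[x₁,y₁)`, so it lies on one side
        -- of it. On the left `r` is a single affine piece, on the right it is the identity; either
        -- way the image lands in the second affine piece of `e`.
        have hcase : d' ≤ x₁ ∨ y₁ ≤ c' := by
          by_contra hcon
          push Not at hcon
          have h1 : max c' x₁ < d' := max_lt hcd' hcon.1
          have h2 : max c' x₁ < y₁ := max_lt hcon.2 hxy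
          have := (himg ⟨max c' x₁, hc'.trans (le_max_left _ _), by linarith⟩
            (le_max_left _ _) h1).1
          rcases this with h | h
          · exact absurd h (not_lt.2 (le_max_right _ _))
          · exact absurd h (not_le.2 h2)
        obtain ⟨c₂, d₂, hmc₂, hcd₂, hdq₂, hr'⟩ : ∃ c₂ d₂, p + y₁ - x₁ ≤ c₂ ∧ c₂ < d₂ ∧ d₂ ≤ q ∧
            MapsAffinely r c' d' c₂ d₂ := by
          rcases hcase with h | h
          · obtain ⟨u, v, h1, h2, h3, h4⟩ :=
              (hr3 (by linarith)).exists_sub (by linarith) hpc' hcd' h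
            exact ⟨u, v, h1, h2, h3.trans hyq, h4⟩
          · exact ⟨c', d', by linarith, hcd', hd'q, MapsAffinely.of_apply_eq_self fun x hx _ =>
              hr x (Or.inr (h.trans hx))⟩
        obtain ⟨c₃, d₃, -, hcd₃, -, he'⟩ := hE2.exists_sub hbq hmc₂ hcd₂ hdq₂
        exact ((he'.mul hr' hcd₂).mul hmc hcd').isDirectAffineOnIco hcd hcd₃
    have : y = (e * r)⁻¹ * (e * r * y) := by group
    rw [this]
    exact K.mul_mem (K.inv_mem (K.mul_mem hEK hrK)) hz

end IntervalExchange

namespace IntervalExchange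

open scoped commutatorElement

/-! ### Groups between the circle group and the affine interval exchanges -/

/-- The properties shared by `PL⁺(𝕊¹)`, read on `[0,1)`, and `𝒜⁺(I)`. -/
structure IsRich (G : Subgroup (Equiv.Perm I)) : Prop where
  scale_stretch : ∀ {a c : ℝ} (h : IsSub a c) (b b'), scale h (stretch b b') ∈ G
  rot_mem : ∀ {α : ℝ}, 0 < α → α < 1 → rot α ∈ G
  isAIET : ∀ {f}, f ∈ G → IsAIET f
  -- The two alternatives match those of `mem_of_affine_pieces`: increasing elements need no
  -- rotations (the circle), otherwise rescaled rotations belong to the group (`𝒜⁺(I)`).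
  strictMono_or : (∀ {f p q}, f ∈ G → 0 < p → p ≤ 1 → f ∈ fixingOff p q → StrictMono f) ∨
    ∀ {a c : ℝ} (h : IsSub a c) {u}, u ∈ G → scale h u ∈ G

theorem isRich_circlePL : IsRich CirclePL where
  scale_stretch h b b' := mem_circlePL_of_strictMono
    (scale_strictMono h (strictMono_stretch b b')) (isAIET_scale h (isAIET_stretch b b'))
  rot_mem := rot_mem_circlePL
  isAIET := fun h => circlePL_le h
  strictMono_or := Or.inl fun hf hp hp1 hs => strictMono_of_mem_circlePL hf hp hp1 hs

theorem isRich_affinePlus : IsRich AffinePlus where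
  scale_stretch h b b' := isAIET_scale h (isAIET_stretch b b')
  rot_mem := isAIET_rot
  isAIET := id
  strictMono_or := Or.inr fun h _ hu => isAIET_scale h hu

namespace IsRich

variable {G : Subgroup (Equiv.Perm I)} (hG : IsRich G)

include hG

/-- Compactly supported elements act transitively on intervals, by affine maps. -/
theorem exists_mapsAffinely {p q a c a' c' : ℝ} (hp : 0 ≤ p) (hq : q ≤ 1) (hpa : p < a)
    (hac : a < c) (hcq : c < q) (hpa' : p < a') (hac' : a' < c') (hcq' : c' < q) :
    ∃ g ∈ G ⊓ fixingOff p q, MapsAffinely g a c a' c' := by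
  have h1 : IsSub p q := ⟨hp, by linarith, hq⟩
  have h2 : IsSub a' q := ⟨by linarith, by linarith, hq⟩
  -- A first stretch on `[p,q)` moves `a` to `a'`; a second one, on `[a',q)`, keeps `a'` and moves
  -- the image of `c` to `c'`.
  obtain ⟨β, β', -, hm⟩ := exists_stretch (b := a) (b' := a') h1 ⟨hpa, by linarith⟩
    ⟨hpa', by linarith⟩
  have hqa : 0 < q - a := by linarith
  have hlt : (q - a') / (q - a) * (c - a) < q - a' := by
    rw [div_mul_eq_mul_div, div_lt_iff₀ hqa]; nlinarith
  have hpos : 0 < (q - a') / (q - a) * (c - a) :=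
    mul_pos (div_pos (by linarith) hqa) (by linarith)
  have hm' : MapsAffinely (scale h1 (stretch β β')) a c a'
      (a' + (q - a') / (q - a) * (c - a)) := by
    refine hm.sub le_rfl hac hcq.le (by ring) ?_
    field_simp
    ring
  obtain ⟨γ, γ', hn, -⟩ := exists_stretch (b := a' + (q - a') / (q - a) * (c - a)) (b' := c') h2
    ⟨by linarith, by linarith⟩ ⟨hac', hcq'⟩
  exact ⟨scale h2 (stretch γ γ') * scale h1 (stretch β β'),
    mul_mem ⟨hG.scale_stretch h2 γ γ',
      fixingOff_mono hpa'.le le_rfl (scale_mem_fixingOff h2 _)⟩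
      ⟨hG.scale_stretch h1 β β', scale_mem_fixingOff h1 _⟩,
    hn.mul hm' (by linarith)⟩

/-! ### Compactly supported elements are products of commutators -/

omit hG in
/-- A two-piece map on `[st,1)` as a product of a two-piece map on `[0,s)` and one on `[0,1)`. -/
theorem scale_stretch_eq {s t α β : Set.Ioo (0 : ℝ) 1} (h1 : IsSub ((s : ℝ) * t) 1)
    (h2 : IsSub 0 (s : ℝ)) (hα : s * t + (1 - s * t) * α = (t : ℝ))
    (hβ : s * t + (1 - s * t) * β = (s : ℝ)) :
    scale h1 (stretch α β) = scale h2 (stretch s t) * stretch t s := by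
  obtain ⟨s0, s1⟩ := s.2
  obtain ⟨t0, t1⟩ := t.2
  obtain ⟨α0, α1⟩ := α.2
  obtain ⟨β0, β1⟩ := β.2
  have hst0 : 0 < (s : ℝ) * t := mul_pos s0 t0
  have hss0 : 0 < (s : ℝ) * s := mul_pos s0 s0
  have hst : (s : ℝ) * t < t := by nlinarith
  have hst' : (s : ℝ) * t < s := by nlinarith
  have hss : (s : ℝ) * s < s := by nlinarith
  have hL := (stretch_left α β).scale h1 le_rfl α0 α1.le
  have hR := (stretch_right α β).scale h1 α0.le α1 le_rfl
  rw [hα, hβ, mul_zero, add_zero] at hL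
  rw [hα, hβ, mul_one, add_sub_cancel] at hR
  have hL' := (stretch_left s t).scale h2 le_rfl s0 s1.le
  have hR' := (stretch_right s t).scale h2 s0.le s1 le_rfl
  simp only [zero_add, sub_zero, mul_zero, mul_one] at hL' hR'
  -- `stretch t s` takes `s * t` to `s * s`, the break of the rescaled `stretch s t`, which takes it
  -- back to `s * t`. Hence the cancellation on `[0,st)` and the single break at `t` beyond it.
  have g1 : MapsAffinely (stretch t s) 0 (s * t) 0 (s * s) :=
    (stretch_left t s).sub le_rfl hst0 hst.le (by ring) (by ring)
  have g2 : MapsAffinely (stretch t s) (s * t) t (s * s) s :=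
    (stretch_left t s).sub hst0.le hst le_rfl (by ring) (by ring)
  have k1 := hL'.mul g1 hss0
  have k2 := hR'.mul g2 hss
  ext x : 1
  rcases lt_or_ge (x : ℝ) (s * t) with hx | hx
  · rw [scale_mem_fixingOff h1 _ x (Or.inl hx), k1.apply_eq_self x.2.1 hx]
  · rcases lt_or_ge (x : ℝ) t with hx' | hx'
    · exact hL.apply_eq k2 hx hx'
    · rw [Equiv.Perm.mul_apply, scale_mem_fixingOff h2 _ _
        (Or.inr ((stretch_right t s).mem s1 hx' x.2.2).1)]
      exact hR.apply_eq (stretch_right t s) hx' x.2.2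

/-- In `scale_stretch_eq` the first factor is a rescaled copy of the inverse of the second, so it is
conjugate to that inverse by some `S`, and the product is a commutator. Solving for the breaks gives
`t = α / (1 - β)` and `s = β / (1 - α)`, both below `1` exactly when `α + β < 1`. The enlarged
support gives room for the conjugators. -/
theorem scale_stretch_mem_of_small {p q p' q' a c : ℝ} (hp' : 0 ≤ p') (hpp : p' < p) (hpq : p < q)
    (hqq : q < q') (hq' : q' ≤ 1) (h : IsSub a c) (hpa : p ≤ a) (hcq : c ≤ q)
    {α β : Set.Ioo (0 : ℝ) 1} (hαβ : (α : ℝ) + β < 1) :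
    scale h (stretch α β) ∈ ⁅G ⊓ fixingOff p' q', G ⊓ fixingOff p' q'⁆ := by
  obtain ⟨α0, α1⟩ := α.2
  obtain ⟨β0, β1⟩ := β.2
  have hα1 : 0 < 1 - (α : ℝ) := by linarith
  have hβ1 : 0 < 1 - (β : ℝ) := by linarith
  obtain ⟨t, ht⟩ : ∃ t : Set.Ioo (0 : ℝ) 1, (t : ℝ) = α / (1 - β) :=
    ⟨⟨_, div_pos α0 hβ1, by rw [div_lt_one hβ1]; linarith⟩, rfl⟩
  obtain ⟨s, hs⟩ : ∃ s : Set.Ioo (0 : ℝ) 1, (s : ℝ) = β / (1 - α) :=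
    ⟨⟨_, div_pos β0 hα1, by rw [div_lt_one hα1]; linarith⟩, rfl⟩
  have s0 := s.2.1
  have s1 := s.2.2
  have t0 := t.2.1
  have t1 := t.2.2
  have hst0 : 0 < (s : ℝ) * t := mul_pos s0 t0
  have hst1 : (s : ℝ) * t < 1 := by nlinarith
  have h1 : IsSub ((s : ℝ) * t) 1 := ⟨hst0.le, hst1, le_rfl⟩
  have h2 : IsSub 0 (s : ℝ) := ⟨le_rfl, s0, s1.le⟩
  have hα : s * t + (1 - s * t) * α = (t : ℝ) := by
    rw [hs, ht]; field_simp; ring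
  have hβ : s * t + (1 - s * t) * β = (s : ℝ) := by
    rw [hs, ht]; field_simp; ring
  have key := scale_stretch_eq h1 h2 hα hβ
  have hA : IsSub p q := ⟨by linarith, hpq, by linarith⟩
  have hqp : 0 < q - p := by linarith
  have hA1 : IsSub (p + (q - p) * (s * t)) q :=
    ⟨by nlinarith, by nlinarith, by linarith⟩
  have hA2 : IsSub p (p + (q - p) * s) := ⟨by linarith, by nlinarith, by nlinarith⟩
  have key' := congrArg (scale hA) key
  rw [map_mul, scale_scale hA h1 hA1 rfl (by ring), scale_scale hA h2 hA2 (by ring) rfl] at key'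
  obtain ⟨S, hS, hSm⟩ := hG.exists_mapsAffinely hp' hq' hpp hpq hqq hpp (c' := p + (q - p) * s)
    (by nlinarith) (by nlinarith)
  rw [← conj_scale hA hA2 hSm, ← stretch_inv t s, map_inv] at key'
  have hL : scale hA (stretch t s) ∈ G ⊓ fixingOff p' q' :=
    ⟨hG.scale_stretch hA t s, fixingOff_mono hpp.le hqq.le (scale_mem_fixingOff hA _)⟩
  have hmem : scale hA1 (stretch α β) ∈ ⁅G ⊓ fixingOff p' q', G ⊓ fixingOff p' q'⁆ := by
    have := Subgroup.commutator_mem_commutator hS (inv_mem hL)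
    rwa [commutatorElement_def, inv_inv, ← key'] at this
  -- The commutator found lives on one particular subinterval; conjugation carries it to `[a,c)`.
  obtain ⟨g, hg, hgm⟩ := hG.exists_mapsAffinely (a := p + (q - p) * (s * t)) (c := q) (a' := a)
    (c' := c) hp' hq' (by nlinarith) (by nlinarith) hqq (by linarith) h.2.1 (by linarith)
  rw [← conj_scale hA1 h hgm]
  exact conj_mem_commutator hg hmem

/-- Factor through an intermediate break `γ` so small that `b + γ < 1` and `γ + b' < 1`. -/
theorem scale_stretch_mem {p q p' q' a c : ℝ} (hp' : 0 ≤ p') (hpp : p' < p) (hpq : p < q)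
    (hqq : q < q') (hq' : q' ≤ 1) (h : IsSub a c) (hpa : p ≤ a) (hcq : c ≤ q)
    (b b' : Set.Ioo (0 : ℝ) 1) :
    scale h (stretch b b') ∈ ⁅G ⊓ fixingOff p' q', G ⊓ fixingOff p' q'⁆ := by
  obtain ⟨b0, b1⟩ := b.2
  obtain ⟨b0', b1'⟩ := b'.2
  have hm : 0 < min (1 - (b : ℝ)) (1 - b') := lt_min (by linarith) (by linarith)
  have hm1 := min_le_left (1 - (b : ℝ)) (1 - b')
  have hm2 := min_le_right (1 - (b : ℝ)) (1 - b')
  obtain ⟨γ, hγ⟩ : ∃ γ : Set.Ioo (0 : ℝ) 1, (γ : ℝ) = min (1 - (b : ℝ)) (1 - b') / 2 :=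
    ⟨⟨_, by linarith, by linarith⟩, rfl⟩
  have e : stretch b b' = stretch γ b' * stretch b γ := by
    ext x : 1
    rcases lt_or_ge (x : ℝ) b with hx | hx
    · exact (stretch_left b b').apply_eq ((stretch_left γ b').mul (stretch_left b γ) γ.2.1)
        x.2.1 hx
    · exact (stretch_right b b').apply_eq ((stretch_right γ b').mul (stretch_right b γ) γ.2.2)
        hx x.2.2
  rw [e, map_mul]
  exact mul_mem (hG.scale_stretch_mem_of_small hp' hpp hpq hqq hq' h hpa hcq (by linarith))
    (hG.scale_stretch_mem_of_small hp' hpp hpq hqq hq' h hpa hcq (by linarith))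

omit hG in
theorem isSub_left : IsSub 0 (1 / 2) := ⟨by norm_num, by norm_num, by norm_num⟩

omit hG in
theorem isSub_right : IsSub (1 / 2) 1 := ⟨by norm_num, by norm_num, by norm_num⟩

omit hG in
theorem isSub_middle : IsSub (1 / 4) (3 / 4) := ⟨by norm_num, by norm_num, by norm_num⟩

omit hG in
/-- Exchanging the two halves of `[0,1)` is conjugate to exchanging quarters in each half. -/
theorem rot_half_eq : rot (1 / 2) = scale isSub_middle (rot (1 / 2)) *
    (scale isSub_left (rot (1 / 2)) * scale isSub_right (rot (1 / 2))) *
    (scale isSub_middle (rot (1 / 2)))⁻¹ := by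
  have h0 : (0 : ℝ) < 1 / 2 := by norm_num
  have h1 : (1 / 2 : ℝ) < 1 := by norm_num
  have L := rot_left h0 h1
  have R := rot_right h0 h1
  rw [show (1 : ℝ) - 1 / 2 = 1 / 2 by norm_num] at L R
  have ml := L.scale isSub_middle le_rfl h0 h1.le
  have mr := R.scale isSub_middle h0.le h1 le_rfl
  have ll := L.scale isSub_left le_rfl h0 h1.le
  have lr := R.scale isSub_left h0.le h1 le_rfl
  have rl := L.scale isSub_right le_rfl h0 h1.le
  have rr := R.scale isSub_right h0.le h1 le_rfl
  have mf := scale_mem_fixingOff isSub_middle (rot (1 / 2))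
  have lf := scale_mem_fixingOff isSub_left (rot (1 / 2))
  have rf := scale_mem_fixingOff isSub_right (rot (1 / 2))
  norm_num at ml mr ll lr rl rr
  -- Written as `τ * m = m * (l * r)`, the identity is checked quarter by quarter: both sides are
  -- affine there with the same image.
  rw [eq_mul_inv_iff_mul_eq]
  have a1 : MapsAffinely (rot (1 / 2)) 0 (1 / 4) (1 / 2) (3 / 4) :=
    L.sub le_rfl (by norm_num) (by norm_num) (by norm_num) (by norm_num)
  have a2 : MapsAffinely (rot (1 / 2)) (1 / 4) (1 / 2) (3 / 4) 1 :=
    L.sub (by norm_num) (by norm_num) le_rfl (by norm_num) (by norm_num)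
  have a3 : MapsAffinely (rot (1 / 2)) (1 / 2) (3 / 4) 0 (1 / 4) :=
    R.sub le_rfl (by norm_num) (by norm_num) (by norm_num) (by norm_num)
  have a4 : MapsAffinely (rot (1 / 2)) (3 / 4) 1 (1 / 4) (1 / 2) :=
    R.sub (by norm_num) (by norm_num) le_rfl (by norm_num) (by norm_num)
  generalize scale isSub_middle (rot (1 / 2)) = m at *
  generalize scale isSub_left (rot (1 / 2)) = l at *
  generalize scale isSub_right (rot (1 / 2)) = r at *
  generalize rot (1 / 2) = τ at *
  have m1 : MapsAffinely m 0 (1 / 4) 0 (1 / 4) :=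
    MapsAffinely.of_apply_eq_self fun x _ hx => mf x (Or.inl hx)
  have m4 : MapsAffinely m (3 / 4) 1 (3 / 4) 1 :=
    MapsAffinely.of_apply_eq_self fun x hx _ => mf x (Or.inr hx)
  have l3 : MapsAffinely l (1 / 2) (3 / 4) (1 / 2) (3 / 4) :=
    MapsAffinely.of_apply_eq_self fun x hx _ => lf x (Or.inr hx)
  have l4 : MapsAffinely l (3 / 4) 1 (3 / 4) 1 :=
    MapsAffinely.of_apply_eq_self fun x hx _ => lf x (Or.inr (by linarith))
  have r1 : MapsAffinely r 0 (1 / 4) 0 (1 / 4) :=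
    MapsAffinely.of_apply_eq_self fun x _ hx => rf x (Or.inl (by linarith))
  have r2 : MapsAffinely r (1 / 4) (1 / 2) (1 / 4) (1 / 2) :=
    MapsAffinely.of_apply_eq_self fun x _ hx => rf x (Or.inl hx)
  ext x : 1
  rcases lt_or_ge (x : ℝ) (1 / 4) with hx | hx
  · exact (a1.mul m1 (by norm_num)).apply_eq
      (ml.mul (ll.mul r1 (by norm_num)) (by norm_num)) x.2.1 hx
  rcases lt_or_ge (x : ℝ) (1 / 2) with hx' | hx'
  · exact (a3.mul ml (by norm_num)).apply_eq
      (m1.mul (lr.mul r2 (by norm_num)) (by norm_num)) hx hx'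
  rcases lt_or_ge (x : ℝ) (3 / 4) with hx'' | hx''
  · exact (a2.mul mr (by norm_num)).apply_eq
      (m4.mul (l4.mul rl (by norm_num)) (by norm_num)) hx' hx''
  · exact (a4.mul m4 (by norm_num)).apply_eq
      (mr.mul (l3.mul rr (by norm_num)) (by norm_num)) hx'' x.2.2

omit hG in
-- Every rotation exchanges two intervals. Stretching before and after moves its break and the break
-- of its image to `1 / 2`.
theorem rot_eq {α : ℝ} (h0 : 0 < α) (h1 : α < 1) : ∃ b b' c c',
    rot α = stretch b b' * rot (1 / 2) * stretch c c' := by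
  have hh : (1 / 2 : ℝ) ∈ Set.Ioo (0 : ℝ) 1 := by constructor <;> norm_num
  have L := rot_left hh.1 hh.2
  have R := rot_right hh.1 hh.2
  rw [show (1 : ℝ) - 1 / 2 = 1 / 2 by norm_num] at L R
  refine ⟨⟨1 / 2, hh⟩, ⟨α, h0, h1⟩, ⟨1 - α, by linarith, by linarith⟩, ⟨1 / 2, hh⟩, ?_⟩
  ext x : 1
  rcases lt_or_ge (x : ℝ) (1 - α) with hx | hx
  · exact (rot_left h0 h1).apply_eq (((stretch_right _ _).mul L hh.2).mul
      (stretch_left ⟨1 - α, by linarith, by linarith⟩ _) hh.1) x.2.1 hx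
  · exact (rot_right h0 h1).apply_eq (((stretch_left _ _).mul R hh.1).mul
      (stretch_right ⟨1 - α, by linarith, by linarith⟩ _) hh.2) hx x.2.2

/-- By `rot_eq` and the case of two-piece maps only the half exchange matters. On `[a,c)` it is
conjugate to the product of its copies on the two halves, each conjugate to the original, so it is
trivial in the abelianization. -/
theorem scale_rot_mem (hsc : ∀ {a c : ℝ} (h : IsSub a c) {u}, u ∈ G → scale h u ∈ G)
    {p q p' q' a c : ℝ} (hp' : 0 ≤ p') (hpp : p' < p) (hpq : p < q) (hqq : q < q') (hq' : q' ≤ 1)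
    (h : IsSub a c) (hpa : p ≤ a) (hcq : c ≤ q) {α : ℝ} (h0 : 0 < α) (h1 : α < 1) :
    scale h (rot α) ∈ ⁅G ⊓ fixingOff p' q', G ⊓ fixingOff p' q'⁆ := by
  obtain ⟨b, b', e, e', hrot⟩ := rot_eq h0 h1
  rw [hrot, map_mul, map_mul]
  refine mul_mem (mul_mem (hG.scale_stretch_mem hp' hpp hpq hqq hq' h hpa hcq _ _) ?_)
    (hG.scale_stretch_mem hp' hpp hpq hqq hq' h hpa hcq _ _)
  have hac := h.2.1
  have hmem : ∀ {s t : ℝ} (k : IsSub s t), a ≤ s → t ≤ c →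
      scale k (rot (1 / 2)) ∈ G ⊓ fixingOff p' q' := fun k hs ht =>
    ⟨hsc k (hG.rot_mem (by norm_num) (by norm_num)),
      fixingOff_mono (by linarith) (by linarith) (scale_mem_fixingOff k _)⟩
  have key := congrArg (scale h) rot_half_eq
  simp only [map_mul, map_inv] at key
  have kl : IsSub a (a + (c - a) * (1 / 2)) := ⟨h.1, by linarith, by linarith [h.2.2]⟩
  have kr : IsSub (a + (c - a) * (1 / 2)) c := ⟨by linarith [h.1], by linarith, h.2.2⟩
  have km : IsSub (a + (c - a) * (1 / 4)) (a + (c - a) * (3 / 4)) :=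
    ⟨by linarith [h.1], by linarith, by linarith [h.2.2]⟩
  rw [scale_scale h isSub_left kl (by ring) rfl, scale_scale h isSub_right kr rfl (by ring),
    scale_scale h isSub_middle km rfl rfl] at key
  obtain ⟨g₁, hg₁, hm₁⟩ := hG.exists_mapsAffinely (a := a) (c := c) (a' := a)
    (c' := a + (c - a) * (1 / 2)) hp' hq' (by linarith) hac (by linarith) (by linarith)
    (by linarith) (by linarith)
  obtain ⟨g₂, hg₂, hm₂⟩ := hG.exists_mapsAffinely (a := a) (c := c) (a' := a + (c - a) * (1 / 2))
    (c' := c) hp' hq' (by linarith) hac (by linarith) (by linarith)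
    (by linarith) (by linarith)
  rw [← conj_scale h kl hm₁, ← conj_scale h kr hm₂] at key
  exact mem_commutator_of_conj_mul_conj (hmem h le_rfl le_rfl) hg₁ hg₂
    (hmem km (by linarith) (by linarith)) key

/-- Elements with compact support are products of commutators of elements with slightly larger
support. -/
theorem inf_fixingOff_le {p q p' q' : ℝ} (hp' : 0 ≤ p') (hpp : p' < p) (hpq : p < q) (hqq : q < q')
    (hq' : q' ≤ 1) :
    G ⊓ fixingOff p q ≤ ⁅G ⊓ fixingOff p' q', G ⊓ fixingOff p' q'⁆ := by
  rintro y ⟨hy, hyf⟩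
  obtain ⟨D, hD⟩ := (isAIET_iff y).1 (hG.isAIET hy)
  -- With `mono` taken to be the monotonicity of `y` itself, one call serves both alternatives of
  -- `strictMono_or`.
  refine mem_of_affine_pieces (p₀ := p) (q := q) (mono := StrictMono y) (by linarith)
    (by linarith) (fun h ha b b' => hG.scale_stretch_mem hp' hpp hpq hqq hq' h ha le_rfl b b') ?_ _
    p le_rfl hpq y hyf id (D.filter fun x => p < x ∧ x < q) ?_ rfl ?_
  · rcases hG.strictMono_or with hm | hm
    · exact Or.inl (hm hy (by linarith) (by linarith) hyf)
    · exact Or.inr fun h ha hc α h0 h1 =>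
        hG.scale_rot_mem hm hp' hpp hpq hqq hq' h ha hc h0 h1
  · intro x hx
    exact (Finset.mem_filter.1 hx).2
  · intro c d hc hcd hd hav
    refine hD c d (by linarith) hcd (by linarith) fun x hx hxx => ?_
    exact hav x (Finset.mem_filter.2 ⟨hx, by linarith [hxx.1], by linarith [hxx.2]⟩) hxx

/-! ### Displacement, fragmentation and the bound of sixteen conjugates -/

/-- An element with compact support is a product of two commutators of elements with compact
support. -/
theorem exists_two_commutators {p q : ℝ} (hp : 0 < p) (hpq : p < q) (hq : q < 1)
    {y : Equiv.Perm I} (hy : y ∈ G ⊓ fixingOff p q) :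
    ∃ p' q', 0 < p' ∧ p' < q' ∧ q' < 1 ∧ ∃ A ∈ G ⊓ fixingOff p' q', ∃ B ∈ G ⊓ fixingOff p' q',
      ∃ C ∈ G ⊓ fixingOff p' q', ∃ D ∈ G ⊓ fixingOff p' q', y = ⁅A, B⁆ * ⁅C, D⁆ := by
  have hsub : IsSub (p / 4) ((3 + q) / 4) := ⟨by linarith, by linarith, by linarith⟩
  -- The points are ordered `p/4 < p/2 < p < q < (1+q)/2 < (3+q)/4 < 1`. The map `t` pushes
  -- `[p/2,(3+q)/4)` onto `[(1+q)/2,(3+q)/4)`: it takes the support of `H` off itself and sends the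
  -- interval carrying `V` into itself.
  obtain ⟨β, β', -, ht⟩ := exists_stretch (b := p / 2) (b' := (1 + q) / 2) hsub
    ⟨by linarith, by linarith⟩ ⟨by linarith, by linarith⟩
  have htL : scale hsub (stretch β β') ∈ G ⊓ fixingOff (p / 4) ((3 + q) / 4) :=
    ⟨hG.scale_stretch hsub _ _, scale_mem_fixingOff hsub _⟩
  generalize scale hsub (stretch β β') = t at ht htL
  have hy' := hG.inf_fixingOff_le (p' := p / 2) (q' := (1 + q) / 2) (by linarith) (by linarith) hpq
    (by linarith) (by linarith) hy
  have hpush : ∀ {r s : ℝ}, p / 2 ≤ r → s ≤ (3 + q) / 4 → ∀ a ∈ G ⊓ fixingOff r s,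
      t * a * t⁻¹ ∈ G ⊓ fixingOff ((1 + q) / 2) ((3 + q) / 4) := fun hr hs a ha =>
    ⟨mul_mem (mul_mem htL.1 ha.1) (G.inv_mem htL.1),
      conj_mem_fixingOff ht (by linarith) (fixingOff_mono hr hs ha.2)⟩
  obtain ⟨F, hF, A, hA, B, hB, h⟩ := _root_.exists_two_commutators
    (V := G ⊓ fixingOff ((1 + q) / 2) ((3 + q) / 4))
    (inf_le_inf_left G (fixingOff_mono (by linarith) (by linarith)))
    (inf_le_inf_left G (fixingOff_mono (by linarith) (by linarith))) htL
    (fun a ha b hb => commute_of_mem_fixingOff le_rfl ha.2 hb.2)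
    (hpush le_rfl (by linarith)) (hpush (by linarith) le_rfl) hy'
  exact ⟨p / 4, (3 + q) / 4, by linarith, by linarith, by linarith, F, hF, t, htL, A, hA, B, hB, h⟩

omit hG in
/-- A nontrivial affine interval exchange displaces some interval. -/
theorem exists_displaced {f : Equiv.Perm I} (hf : IsAIET f) (hf1 : f ≠ 1) :
    ∃ a c : ℝ, 0 < a ∧ a < c ∧ c < 1 ∧ ∀ x : I, a ≤ x → (x : ℝ) < c → ((f x : ℝ) < a ∨ c ≤ f x) := by
  obtain ⟨x, hx⟩ : ∃ x, f x ≠ x := by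
    by_contra hcon
    push Not at hcon
    exact hf1 (Equiv.ext hcon)
  obtain ⟨p, b, hb, hb0, hb1, hP⟩ := hf
  obtain ⟨i, hi, hi'⟩ := exists_piece hb0 hb1 x.2.1 x.2.2
  obtain ⟨l, k, hl, hlk⟩ := hP i
  have hlast : b i.succ ≤ 1 := by rw [← hb1]; exact hb.monotone (Fin.le_last _)
  have hfx := hlk x hi hi'
  have hne : (f x : ℝ) ≠ x := fun h => hx (Subtype.ext h)
  have hx0 := x.2.1
  rcases lt_or_gt_of_ne hne with hlt | hlt
  -- The interval is `[x + ε, x + 2ε)`, not one starting at `x`, so that its left end is positive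
  -- even if `x = 0`.
  · obtain ⟨ε, hε0, hε1, hε2⟩ : ∃ ε : ℝ, 0 < ε ∧ x + 2 * ε < b i.succ ∧ f x + l * (2 * ε) < x := by
      refine ⟨min ((b i.succ - x) / 4) ((x - f x) / (4 * l)),
        lt_min (by linarith) (div_pos (by linarith) (by linarith)), ?_, ?_⟩
      · linarith [min_le_left ((b i.succ - x) / 4) ((x - f x) / (4 * l))]
      · have := mul_le_mul_of_nonneg_left
          (min_le_right ((b i.succ - x) / 4) ((x - f x) / (4 * l))) hl.le
        have e : l * ((x - f x) / (4 * l)) = (x - f x) / 4 := by field_simp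
        rw [e] at this
        linarith
    refine ⟨x + ε, x + 2 * ε, by linarith, by linarith, by linarith, fun z hz hz' => Or.inl ?_⟩
    rw [hlk z (by linarith) (by linarith)]
    nlinarith
  · obtain ⟨ε, hε0, hε1, hε2⟩ : ∃ ε : ℝ, 0 < ε ∧ x + 2 * ε < b i.succ ∧ x + 2 * ε < f x := by
      refine ⟨min ((b i.succ - x) / 4) ((f x - x) / 4),
        lt_min (by linarith) (by linarith), ?_, ?_⟩
      · linarith [min_le_left ((b i.succ - x) / 4) ((f x - x) / 4)]
      · linarith [min_le_right ((b i.succ - x) / 4) ((f x - x) / 4)]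
    refine ⟨x + ε, x + 2 * ε, by linarith, by linarith, by linarith, fun z hz hz' => Or.inr ?_⟩
    rw [hlk z (by linarith) (by linarith)]
    nlinarith

/-- Conjugate `A` and `B` into an interval displaced by `f`; conjugating there by `f` makes supports
disjoint, so the group-theoretic lemma applies. It speaks of `⁅a⁻¹, b⁆`, hence its use with the
inverse of `A`. -/
theorem conjProd_commutator {f : Equiv.Perm I} (hf : f ∈ G) (hf1 : f ≠ 1) {p q : ℝ} (hp : 0 < p)
    (hpq : p < q) (hq : q < 1) {A B : Equiv.Perm I} (hA : A ∈ G ⊓ fixingOff p q)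
    (hB : B ∈ G ⊓ fixingOff p q) : ConjProd G f 4 ⁅A, B⁆ := by
  obtain ⟨a, c, ha, hac, hc, hd⟩ := exists_displaced (hG.isAIET hf) hf1
  obtain ⟨g, hg, hgm⟩ := hG.exists_mapsAffinely le_rfl le_rfl hp hpq hq ha hac hc
  have hcomm : ∀ {u v : Equiv.Perm I}, u ∈ fixingOff a c → v ∈ fixingOff a c →
      Commute (f * u * f⁻¹) v := by
    intro u v hu hv
    apply Equiv.Perm.Disjoint.commute
    intro z
    by_cases hz : a ≤ z ∧ (z : ℝ) < c
    · left
      rw [Equiv.Perm.mul_apply, Equiv.Perm.mul_apply, hu, perm_apply_inv]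
      by_contra hcon
      push Not at hcon
      have := hd _ hcon.1 hcon.2
      rw [perm_apply_inv] at this
      rcases this with h | h <;> linarith [hz.1, hz.2]
    · right
      refine hv z ?_
      by_contra hcon
      push Not at hcon
      exact hz hcon
  have hconj : ∀ {u : Equiv.Perm I}, u ∈ G ⊓ fixingOff p q →
      g * u * g⁻¹ ∈ G ∧ g * u * g⁻¹ ∈ fixingOff a c := fun hu =>
    ⟨mul_mem (mul_mem hg.1 hu.1) (inv_mem hg.1), conj_mem_fixingOff hgm hac hu.2⟩
  have hA' := hconj (inv_mem hA)
  have hB' := hconj hB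
  have h := _root_.conjProd_commutator (f := f) hA'.1 hB'.1 (hcomm hA'.2 hA'.2)
    (hcomm hA'.2 hB'.2)
  have := h.conj (inv_mem hg.1)
  convert this using 1
  rw [commutatorElement_def, commutatorElement_def]
  group

theorem conjProd_of_mem_fixingOff {f : Equiv.Perm I} (hf : f ∈ G) (hf1 : f ≠ 1) {p q : ℝ}
    (hp : 0 < p) (hpq : p < q) (hq : q < 1) {y : Equiv.Perm I} (hy : y ∈ G ⊓ fixingOff p q) :
    ConjProd G f 8 y := by
  obtain ⟨p', q', hp', hpq', hq', A, hA, B, hB, C, hC, D, hD, rfl⟩ :=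
    hG.exists_two_commutators hp hpq hq hy
  exact (hG.conjProd_commutator hf hf1 hp' hpq' hq' hA hB).mul
    (hG.conjProd_commutator hf hf1 hp' hpq' hq' hC hD)

omit hG in
/-- Every affine interval exchange is affine from some interval to another, both having compact
closure in `(0,1)`. -/
theorem exists_affine_interval {φ : Equiv.Perm I} (hφ : IsAIET φ) :
    ∃ q r q' r', 0 < q ∧ q < r ∧ r < 1 ∧ 0 < q' ∧ q' < r' ∧ r' < 1 ∧
      MapsAffinely φ q r q' r' := by
  obtain ⟨p, b, hb, hb0, hb1, hP⟩ := hφ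
  obtain ⟨i, hi, hi'⟩ := exists_piece hb0 hb1 le_rfl one_pos
  have h0 : 0 ≤ b i.castSucc := by rw [← hb0]; exact hb.monotone (Fin.zero_le _)
  have h1 : b i.succ ≤ 1 := by rw [← hb1]; exact hb.monotone (Fin.le_last _)
  have hlt : b i.castSucc < b i.succ := hb Fin.castSucc_lt_succ
  obtain ⟨c, d, hc, hcd, hd, hm⟩ := (hP i).exists_mapsAffinely h0 hlt h1
  refine ⟨(2 * b i.castSucc + b i.succ) / 3, (b i.castSucc + 2 * b i.succ) / 3,
    (2 * c + d) / 3, (c + 2 * d) / 3, by linarith, by linarith, by linarith, by linarith,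
    by linarith, by linarith, hm.sub (by linarith) (by linarith) (by linarith) (by ring) (by ring)⟩

/-- Fragmentation: `φ = ψ * (ψ⁻¹ * φ)`, where `ψ` is compactly supported and copies `φ` on an
interval. Each factor costs eight. -/
theorem conjProd {f φ : Equiv.Perm I} (hf : f ∈ G) (hf1 : f ≠ 1) (hφ : φ ∈ G) :
    ConjProd G f 16 φ := by
  obtain ⟨q, r, q', r', hq, hqr, hr, hq', hqr', hr', hm⟩ :=
    exists_affine_interval (hG.isAIET hφ)
  obtain ⟨δ, hδ, hδ1, hδ2, hδ3, hδ4⟩ : ∃ δ : ℝ, 0 < δ ∧ δ < q ∧ δ < q' ∧ r < 1 - δ ∧ r' < 1 - δ := by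
    have h1 : 0 < min (min q q') (min (1 - r) (1 - r')) :=
      lt_min (lt_min hq hq') (lt_min (by linarith) (by linarith))
    have h2 := (min_le_left (min q q') (min (1 - r) (1 - r'))).trans (min_le_left _ _)
    have h3 := (min_le_left (min q q') (min (1 - r) (1 - r'))).trans (min_le_right _ _)
    have h4 := (min_le_right (min q q') (min (1 - r) (1 - r'))).trans (min_le_left _ _)
    have h5 := (min_le_right (min q q') (min (1 - r) (1 - r'))).trans (min_le_right _ _)
    exact ⟨min (min q q') (min (1 - r) (1 - r')) / 2, by linarith, by linarith, by linarith,
      by linarith, by linarith⟩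
  obtain ⟨ψ, hψ, hψm⟩ := hG.exists_mapsAffinely (p := δ) (q := 1 - δ) hδ.le (by linarith) hδ1 hqr
    hδ3 hδ2 hqr' hδ4
  have hψ8 := hG.conjProd_of_mem_fixingOff hf hf1 hδ (by linarith) (by linarith) hψ
  have hR := hG.rot_mem (α := (q + r) / 2) (by linarith) (by linarith)
  have hfix : ∀ x : I, q ≤ x → (x : ℝ) < r → (ψ⁻¹ * φ) x = x := fun x hx hx' => by
    rw [Equiv.Perm.mul_apply, hm.apply_eq hψm hx hx', perm_inv_apply]
  -- The rotation takes `0` to the midpoint of the interval `[q,r)` fixed by `ψ⁻¹ * φ`, so the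
  -- conjugate is the identity near both ends of `[0,1)`.
  have hθ : (rot ((q + r) / 2))⁻¹ * (ψ⁻¹ * φ) * rot ((q + r) / 2) ∈
      G ⊓ fixingOff ((r - q) / 2) (1 - (r - q) / 2) := by
    refine ⟨mul_mem (mul_mem (G.inv_mem hR) (mul_mem (G.inv_mem hψ.1) hφ)) hR, fun x hx => ?_⟩
    rw [Equiv.Perm.mul_apply, Equiv.Perm.mul_apply, Equiv.Perm.inv_eq_iff_eq]
    have h0 := x.2.1
    have h1 := x.2.2
    rcases hx with hx | hx
    · have e : Int.fract ((q + r) / 2 + (x : ℝ)) = (q + r) / 2 + x :=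
        Int.fract_eq_self.2 ⟨by linarith, by linarith⟩
      apply hfix <;> rw [rot_apply, e] <;> linarith
    · have e : Int.fract ((q + r) / 2 + (x : ℝ)) = (q + r) / 2 + x - 1 := by
        rw [Int.fract_eq_iff]
        exact ⟨by linarith, by linarith, 1, by push_cast; ring⟩
      apply hfix <;> rw [rot_apply, e] <;> linarith
  have hθ8 := (hG.conjProd_of_mem_fixingOff hf hf1 (by linarith) (by linarith) (by linarith)
    hθ).conj hR
  convert hψ8.mul hθ8 using 1
  group

end IsRich

/-! ### Uniform simplicity of the two groups without flips -/

theorem isUniformlySimple_affinePlus : IsUniformlySimple AffinePlus := by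
  refine isUniformlySimple_of_conjProd AffinePlus.subtype Subtype.val_injective (N := 16)
    (by norm_num) ?_
  rw [Subgroup.range_subtype]
  exact fun f hf hf1 φ hφ => isRich_affinePlus.conjProd hf hf1 hφ

theorem isUniformlySimple_PLPlusCircle : IsUniformlySimple PLPlusCircle := by
  refine isUniformlySimple_of_conjProd (readOnI.comp PLPlusCircle.subtype)
    (readOnI_injective.comp Subtype.val_injective) (N := 16) (by norm_num) ?_
  have : (readOnI.comp PLPlusCircle.subtype).range = CirclePL := by
    rw [MonoidHom.range_comp, Subgroup.range_subtype]; rfl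
  rw [this]
  exact fun f hf hf1 φ hφ => isRich_circlePL.conjProd hf hf1 hφ

end IntervalExchange

namespace IntervalExchange

open scoped commutatorElement

/-! ### Affine interval exchanges with flips -/

theorem IsAIET.isFAIET {f : Equiv.Perm I} (hf : IsAIET f) : IsFAIET f := by
  obtain ⟨p, a, ha, h0, h1, h⟩ := hf
  refine ⟨p, a, ha, h0, h1, fun i => ?_⟩
  obtain ⟨l, b, -, hlb⟩ := h i
  exact ⟨l, b, fun x hx hx' => hlb x hx.le hx'⟩

theorem affinePlus_le : AffinePlus ≤ AffineFlipHat := fun _ hf => IsAIET.isFAIET hf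

/-- The class in `𝒜(I)` of an affine interval exchange with flips. -/
def flipClass : AffineFlipHat →* AffineFlip := QuotientGroup.mk' _

/-- The map from `𝒜⁺(I)` to `𝒜(I)`. -/
def plusClass : AffinePlus →* AffineFlip := flipClass.comp (Subgroup.inclusion affinePlus_le)

theorem flipClass_eq_of_finite {x y : AffineFlipHat}
    (h : {z | (x : Equiv.Perm I) z ≠ (y : Equiv.Perm I) z}.Finite) :
    flipClass x = flipClass y := by
  refine QuotientGroup.eq.2 (h.subset fun z hz hxy => hz ?_)
  change (x : Equiv.Perm I)⁻¹ ((y : Equiv.Perm I) z) = z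
  rw [← hxy, perm_inv_apply]

theorem infinite_of_flipClass_ne_one {x : AffineFlipHat} (h : flipClass x ≠ 1) :
    {z | (x : Equiv.Perm I) z ≠ z}.Infinite := fun hfin =>
  h (by rw [← map_one flipClass]; exact flipClass_eq_of_finite hfin)

/-- A cover version of the definition of affine interval exchanges with flips. -/
theorem isFAIET_of_cover {ι : Type*} [Finite ι] {f : Equiv.Perm I} (c d : ι → ℝ)
    (hcov : ∀ x : I, ∃ i, c i ≤ x ∧ (x : ℝ) < d i)
    (h : ∀ i, IsAffineOnIoo f (c i) (d i)) : IsFAIET f := by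
  classical
  have := Fintype.ofFinite ι
  rw [isFAIET_iff]
  refine ⟨Finset.univ.image d, fun u v hu huv hv hD => ?_⟩
  obtain ⟨i, hi, hi'⟩ := hcov ⟨u, hu, by linarith⟩
  obtain ⟨l, b, hlb⟩ := h i
  refine ⟨l, b, fun x hx hx' => hlb x (lt_of_le_of_lt hi hx) ?_⟩
  by_contra hcon
  exact hD (d i) (Finset.mem_image_of_mem _ (Finset.mem_univ _)) ⟨hi', by linarith⟩

/-- Lets right limits and right slopes be compared by evaluation at nearby points only, since
nothing is known of a flipped exchange at its subdivision points. -/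
theorem affine_germ_unique {v l v' l' η : ℝ} (hη : 0 < η)
    (h : ∀ t, 0 < t → t < η → v + l * t = v' + l' * t) : v = v' ∧ l = l' := by
  have h1 := h (η / 2) (by linarith) (by linarith)
  have h2 := h (η / 4) (by linarith) (by linarith)
  have h3 : (l - l') * η = 0 := by linarith
  have h4 : l = l' := by
    rcases mul_eq_zero.1 h3 with h | h <;> linarith
  subst h4
  exact ⟨by linarith, rfl⟩

/-- An affine interval exchange with flips, all of whose slopes are positive, agrees with an affine
interval exchange up to finitely many points. -/
theorem exists_isAIET_of_slopes_pos {ι : Type*} [Finite ι] {g : Equiv.Perm I} (hg : IsFAIET g)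
    (c d : ι → ℝ) (hcov : ∀ x : I, ∃ i, c i ≤ x ∧ (x : ℝ) < d i)
    (h : ∀ i, ∃ l b : ℝ, 0 < l ∧ ∀ x : I, c i < x → (x : ℝ) < d i → (g x : ℝ) = l * x + b) :
    ∃ ψ : Equiv.Perm I, IsAIET ψ ∧ {x | ψ x ≠ g x}.Finite := by
  choose l b hl hlb using h
  -- the right limits of `g`
  have hright : ∀ x : I, ∃ v : I, ∃ η s : ℝ, 0 < η ∧ x + η ≤ 1 ∧ 0 < s ∧
      ∀ z : I, (x : ℝ) < z → (z : ℝ) < x + η → (g z : ℝ) = v + s * (z - x) := by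
    intro x
    obtain ⟨i, hi, hi'⟩ := hcov x
    have hx0 := x.2.1
    have hη : 0 < min (d i) 1 - x := sub_pos.2 (lt_min hi' x.2.2)
    have hm1 := min_le_left (d i) 1
    have hm2 := min_le_right (d i) 1
    have hgz : ∀ z : I, (x : ℝ) < z → (z : ℝ) < x + (min (d i) 1 - x) →
        (g z : ℝ) = (l i * x + b i) + l i * (z - x) := fun z hz hz' => by
      rw [hlb i z (by linarith) (by linarith)]; ring
    have hli := hl i
    refine ⟨⟨l i * x + b i, ?_, ?_⟩, _, l i, hη, by linarith, hli, hgz⟩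
    · by_contra hneg
      push Not at hneg
      have h1 : 0 < min ((min (d i) 1 - x) / 2) (-(l i * x + b i) / (2 * l i)) :=
        lt_min (by linarith) (div_pos (by linarith) (by linarith))
      have h2 := min_le_left ((min (d i) 1 - (x : ℝ)) / 2) (-(l i * x + b i) / (2 * l i))
      have h3 := mul_le_mul_of_nonneg_left
        (min_le_right ((min (d i) 1 - (x : ℝ)) / 2) (-(l i * x + b i) / (2 * l i))) hli.le
      have e : l i * (-(l i * x + b i) / (2 * l i)) = -(l i * x + b i) / 2 := by field_simp
      rw [e] at h3
      generalize min ((min (d i) 1 - (x : ℝ)) / 2) (-(l i * x + b i) / (2 * l i)) = ε at h1 h2 h3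
      have := hgz ⟨x + ε, by linarith, by linarith⟩ (by simp only; linarith)
        (by simp only; linarith)
      have h4 := (g ⟨x + ε, by linarith, by linarith⟩).2.1
      rw [this] at h4
      simp only [add_sub_cancel_left] at h4
      linarith
    · have := hgz ⟨x + (min (d i) 1 - x) / 2, by linarith, by linarith⟩ (by simp only; linarith)
        (by simp only; linarith)
      have h4 := (g ⟨x + (min (d i) 1 - x) / 2, by linarith, by linarith⟩).2.2
      rw [this] at h4
      simp only [add_sub_cancel_left] at h4
      nlinarith
  choose v η s hη hη1 hs hv using hright
  have hval : ∀ x i, c i ≤ (x : I) → (x : ℝ) < d i → (v x : ℝ) = l i * x + b i := by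
    intro x i hi hi'
    have hx0 := x.2.1
    refine (affine_germ_unique (η := min (η x) (d i - x)) (l := s x) (l' := l i)
      (lt_min (hη x) (by linarith)) fun t ht ht' => ?_).1
    have h1 := min_le_left (η x) (d i - x)
    have h2 := min_le_right (η x) (d i - x)
    have h3 := hη1 x
    have e1 := hv x ⟨x + t, by linarith, by linarith⟩ (by simp only; linarith)
      (by simp only; linarith)
    have e2 := hlb i ⟨x + t, by linarith, by linarith⟩ (by simp only; linarith)
      (by simp only; linarith)
    rw [e1] at e2
    simp only [add_sub_cancel_left] at e2
    rw [e2]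
    ring
  -- Two increasing right germs with the same limit take the same values at `x + t` and `y + (s x /
  -- s y) t`. Injectivity of `g` equates these points for all small `t`, and `t → 0` gives `x = y`.
  have hinj : Function.Injective v := by
    intro x y hxy
    have hx0 := x.2.1
    have hy0 := y.2.1
    have hsx := hs x
    have hsy := hs y
    have hηx := hη1 x
    have hηy := hη1 y
    refine Subtype.ext (affine_germ_unique (η := min (η x) (η y * s y / s x)) (l := 1)
      (l' := s x / s y) (lt_min (hη x) (div_pos (mul_pos (hη y) hsy) hsx)) fun t ht ht' => ?_).1
    have h1 := ht'.trans_le (min_le_left _ _)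
    have h2 := ht'.trans_le (min_le_right _ _)
    rw [lt_div_iff₀ hsx] at h2
    have h3 : 0 < s x / s y * t := mul_pos (div_pos hsx hsy) ht
    have h4 : s x / s y * t < η y := by
      rw [div_mul_eq_mul_div, div_lt_iff₀ hsy]; linarith
    have e1 := hv x ⟨x + 1 * t, by linarith, by linarith⟩ (by simp only; linarith)
      (by simp only; linarith)
    have e2 := hv y ⟨y + s x / s y * t, by linarith, by linarith⟩ (by simp only; linarith)
      (by simp only; linarith)
    simp only [add_sub_cancel_left] at e1 e2
    have e3 : s y * (s x / s y * t) = s x * t := by field_simp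
    have : g ⟨x + 1 * t, by linarith, by linarith⟩ =
        g ⟨y + s x / s y * t, by linarith, by linarith⟩ :=
      Subtype.ext (by rw [e1, e2, e3, hxy, one_mul])
    exact congrArg Subtype.val (g.injective this)
  have hsurj : Function.Surjective v := by
    intro y
    -- A preimage of `y` under `v` is the right limit of `g⁻¹` at `y`, once the slope `m` of `g⁻¹`
    -- on the right of `y` is known to be positive.
    obtain ⟨p, a, ha, ha0, ha1, hP⟩ := hg.inv
    obtain ⟨i, hi, hi'⟩ := exists_piece ha0 ha1 y.2.1 y.2.2
    have hi1 : a i.succ ≤ 1 := by rw [← ha1]; exact ha.monotone (Fin.le_last _)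
    have hi0 : 0 ≤ a i.castSucc := by rw [← ha0]; exact ha.monotone (Fin.zero_le _)
    obtain ⟨m, k, hmk⟩ := hP i
    have hm0 : m ≠ 0 := slope_ne_zero hi0 (ha Fin.castSucc_lt_succ) hi1 hmk
    have hy0 := y.2.1
    have hginv : ∀ t, ∀ ht : 0 < t, ∀ ht' : t < a i.succ - y, ∀ z : I,
        (z : ℝ) = m * (y + t) + k → (g z : ℝ) = y + t := by
      intro t ht ht' z hz
      have h1 := hmk ⟨y + t, by linarith, by linarith⟩ (by simp only; linarith)
        (by simp only; linarith)
      have h2 : g⁻¹ ⟨y + t, by linarith, by linarith⟩ = z := Subtype.ext (by rw [h1, hz])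
      rw [← h2, perm_apply_inv]
    have hrange : ∀ t, 0 < t → t < a i.succ - y →
        0 ≤ m * (y + t) + k ∧ m * (y + t) + k < 1 := by
      intro t ht ht'
      have h1 := hmk ⟨y + t, by linarith, by linarith⟩ (by simp only; linarith)
        (by simp only; linarith)
      simp only at h1
      rw [← h1]
      exact (g⁻¹ _).2
    have hgap : 0 < a i.succ - y := by linarith
    rcases lt_or_gt_of_ne hm0 with hneg | hpos
    -- If `m < 0`, then `g` has slope `1 / m < 0` on the right of the point `m * (y + δ) + k`,
    -- against positivity of `s`.
    · exfalso
      have ht1 : 0 < (a i.succ - y) / 2 := by linarith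
      generalize hδ : (a i.succ - (y : ℝ)) / 2 = δ at ht1
      have hx := hrange δ ht1 (by linarith)
      let x : I := ⟨m * (y + δ) + k, hx⟩
      have hxv : (x : ℝ) = m * (y + δ) + k := rfl
      have hsx := hs x
      have hηx := hη1 x
      have := (affine_germ_unique (v := v x) (l := s x) (v' := y + δ) (l' := 1 / m)
        (η := min (η x) (-m * δ)) (lt_min (hη x) (by nlinarith)) fun t ht ht' => ?_).2
      · have h1 : 1 / m < 0 := one_div_neg.2 hneg
        linarith
      · have h1 := ht'.trans_le (min_le_left _ _)
        have h2 := ht'.trans_le (min_le_right _ _)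
        have e1 := hv x ⟨x + t, by linarith [x.2.1], by linarith⟩ (by simp only; linarith)
          (by simp only; linarith)
        simp only [add_sub_cancel_left] at e1
        have h3 : 0 < δ + t / m := by
          have : -δ < t / m := by rw [lt_div_iff_of_neg hneg]; linarith
          linarith
        have h4 : t / m < 0 := div_neg_of_pos_of_neg ht hneg
        have e2 := hginv (δ + t / m) h3 (by linarith) ⟨x + t, by linarith [x.2.1], by linarith⟩
          (by simp only [hxv]; field_simp; ring)
        rw [e1] at e2
        rw [e2]
        ring
    · have hx0 : 0 ≤ m * y + k := by
        have h3 : ∀ t, 0 < t → t < a i.succ - y → -(m * t) ≤ m * y + k := fun t ht ht' => by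
          linarith [(hrange t ht ht').1]
        by_contra hcon
        push Not at hcon
        have h1 : 0 < min ((a i.succ - y) / 2) (-(m * y + k) / (2 * m)) :=
          lt_min (by linarith) (div_pos (by linarith) (by linarith))
        have h2 := min_le_left ((a i.succ - (y : ℝ)) / 2) (-(m * y + k) / (2 * m))
        have h4 := mul_le_mul_of_nonneg_left
          (min_le_right ((a i.succ - (y : ℝ)) / 2) (-(m * y + k) / (2 * m))) hpos.le
        have e : m * (-(m * y + k) / (2 * m)) = -(m * y + k) / 2 := by field_simp
        rw [e] at h4
        have := h3 _ h1 (by linarith)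
        linarith
      have hx1 : m * y + k < 1 := by
        have := (hrange ((a i.succ - y) / 2) (by linarith) (by linarith)).2
        nlinarith
      let x : I := ⟨m * y + k, hx0, hx1⟩
      have hxv : (x : ℝ) = m * y + k := rfl
      have hηx := hη1 x
      refine ⟨x, Subtype.ext (affine_germ_unique (l := s x * m) (l' := 1)
        (η := min (η x / m) (a i.succ - y)) (lt_min (div_pos (hη x) hpos) hgap)
        fun t ht ht' => ?_).1⟩
      have h1 := ht'.trans_le (min_le_left _ _)
      have h2 := ht'.trans_le (min_le_right _ _)
      rw [lt_div_iff₀ hpos] at h1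
      have h3 : 0 < m * t := mul_pos hpos ht
      have e1 := hv x ⟨x + m * t, by linarith, by linarith⟩ (by simp only; linarith)
        (by simp only; linarith)
      simp only [add_sub_cancel_left] at e1
      have e2 := hginv t ht h2 ⟨x + m * t, by linarith, by linarith⟩
        (by simp only [hxv]; ring)
      rw [e1] at e2
      linarith
  refine ⟨Equiv.ofBijective v ⟨hinj, hsurj⟩, isAIET_of_cover c d hcov fun i =>
    ⟨l i, b i, hl i, fun x hx hx' => hval x i hx hx'⟩, ?_⟩
  -- Off the left endpoints of the cover `g` is given by the affine formula, which is also the value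
  -- of its right limit.
  have : ((fun x : I => (x : ℝ)) ⁻¹' Set.range c).Finite :=
    (Set.finite_range c).preimage Subtype.val_injective.injOn
  refine this.subset fun x hx => ?_
  by_contra hcon
  refine hx (Subtype.ext ?_)
  obtain ⟨i, hi, hi'⟩ := hcov x
  have hlt : c i < x := lt_of_le_of_ne hi fun he => hcon ⟨i, he⟩
  rw [hlb i x hlt hi']
  exact hval x i hi hi'

/-! ### Gluing bijections along a subdivision -/

section Glue

variable {p : ℕ} {a : Fin (p + 1) → ℝ} (ha : StrictMono a) (h0 : a 0 = 0) (h1 : a (Fin.last p) = 1)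

include ha h0 h1 in
theorem isSub_of_subdivision (i : Fin p) : IsSub (a i.castSucc) (a i.succ) :=
  ⟨by rw [← h0]; exact ha.monotone (Fin.zero_le _), ha Fin.castSucc_lt_succ,
    by rw [← h1]; exact ha.monotone (Fin.le_last _)⟩

/-- The identification of the disjoint union of the pieces of a subdivision with `[0,1)`. -/
noncomputable def subdivisionEquiv : (Σ _ : Fin p, I) ≃ I :=
  Equiv.ofBijective (fun z => affinePoint (isSub_of_subdivision ha h0 h1 z.1) z.2) (by
    constructor
    · rintro ⟨i, x⟩ ⟨j, y⟩ hxy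
      simp only at hxy
      have hi := affinePoint_mem (isSub_of_subdivision ha h0 h1 i) x
      have hj := affinePoint_mem (isSub_of_subdivision ha h0 h1 j) y
      rw [hxy] at hi
      have h2 := ha.lt_iff_lt.1 (hi.1.trans_lt hj.2)
      have h3 := ha.lt_iff_lt.1 (hj.1.trans_lt hi.2)
      have hij : i = j := by
        rw [Fin.lt_def] at h2 h3
        simp at h2 h3
        omega
      subst hij
      rw [affinePoint_injective _ hxy]
    · intro x
      obtain ⟨i, hi, hi'⟩ := exists_piece h0 h1 x.2.1 x.2.2
      obtain ⟨y, hy⟩ := exists_affinePoint (isSub_of_subdivision ha h0 h1 i) hi hi'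
      exact ⟨⟨i, y⟩, hy⟩)

/-- The bijection of `[0,1)` acting on the `i`-th piece of a subdivision as the rescaled `u i`. -/
noncomputable def glue : (Fin p → Equiv.Perm I) →* Equiv.Perm I :=
  (subdivisionEquiv ha h0 h1).permCongrHom.toMonoidHom.comp
    (Equiv.Perm.sigmaCongrRightHom fun _ : Fin p => I)

theorem glue_affinePoint (u : Fin p → Equiv.Perm I) (i : Fin p) (y : I) :
    glue ha h0 h1 u (affinePoint (isSub_of_subdivision ha h0 h1 i) y) =
      affinePoint (isSub_of_subdivision ha h0 h1 i) (u i y) := by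
  change subdivisionEquiv ha h0 h1 (Equiv.Perm.sigmaCongrRightHom (fun _ : Fin p => I) u
    ((subdivisionEquiv ha h0 h1).symm (subdivisionEquiv ha h0 h1 ⟨i, y⟩))) = _
  rw [Equiv.symm_apply_apply]
  rfl

/-- The left endpoints of the halves of the pieces of a subdivision. -/
noncomputable def halfLeft (a : Fin (p + 1) → ℝ) (j : Fin p × Bool) : ℝ :=
  a j.1.castSucc + (a j.1.succ - a j.1.castSucc) * cond j.2 0 (1 / 2)

/-- The right endpoints of the halves of the pieces of a subdivision. -/
noncomputable def halfRight (a : Fin (p + 1) → ℝ) (j : Fin p × Bool) : ℝ :=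
  a j.1.castSucc + (a j.1.succ - a j.1.castSucc) * cond j.2 (1 / 2) 1

include h0 h1 in
theorem halves_cover (x : I) : ∃ j, halfLeft a j ≤ x ∧ (x : ℝ) < halfRight a j := by
  obtain ⟨i, hi, hi'⟩ := exists_piece h0 h1 x.2.1 x.2.2
  rcases lt_or_ge (x : ℝ) (a i.castSucc + (a i.succ - a i.castSucc) * (1 / 2)) with h | h
  · exact ⟨(i, true), by simpa [halfLeft] using hi, by simpa [halfRight] using h⟩
  · exact ⟨(i, false), by simpa [halfLeft] using h, by simpa [halfRight] using hi'⟩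

/-- The pieces are cut at their midpoints because the bijections to be glued, the half exchange and
the flip of one half, break only there. Rescaling source and target alike preserves slopes. -/
theorem isAIET_glue {u : Fin p → Equiv.Perm I}
    (hu : ∀ i j, IsDirectAffineOnIco (u i) (cond j 0 (1 / 2)) (cond j (1 / 2) 1)) :
    IsAIET (glue ha h0 h1 u) := by
  refine isAIET_of_cover _ _ (halves_cover h0 h1) ?_
  rintro ⟨i, j⟩
  obtain ⟨l, b, hl, hlb⟩ := hu i j
  have hsub := isSub_of_subdivision ha h0 h1 i
  obtain ⟨k1, k2, k3⟩ := id hsub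
  refine ⟨l, a i.castSucc + (a i.succ - a i.castSucc) * b - l * a i.castSucc, hl,
    fun x hx hx' => ?_⟩
  simp only [halfLeft, halfRight] at hx hx'
  obtain ⟨y, rfl⟩ := exists_affinePoint hsub (x := x)
    (by cases j <;> simp only [cond_true, cond_false] at hx hx' <;> nlinarith)
    (by cases j <;> simp only [cond_true, cond_false] at hx hx' <;> nlinarith)
  rw [coe_affinePoint] at hx hx'
  rw [glue_affinePoint, coe_affinePoint, coe_affinePoint, hlb y (by nlinarith) (by nlinarith)]
  ring

theorem exists_affinePoint_half {i : Fin p} {j : Bool} {x : I} (hx : halfLeft a (i, j) < x)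
    (hx' : (x : ℝ) < halfRight a (i, j)) : ∃ y : I, cond j 0 (1 / 2) < (y : ℝ) ∧
      (y : ℝ) < cond j (1 / 2) 1 ∧ affinePoint (isSub_of_subdivision ha h0 h1 i) y = x := by
  obtain ⟨k1, k2, k3⟩ := isSub_of_subdivision ha h0 h1 i
  simp only [halfLeft, halfRight] at hx hx'
  obtain ⟨y, rfl⟩ := exists_affinePoint (isSub_of_subdivision ha h0 h1 i) (x := x)
    (by cases j <;> simp only [cond_true, cond_false] at hx hx' <;> nlinarith)
    (by cases j <;> simp only [cond_true, cond_false] at hx hx' <;> nlinarith)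
  rw [coe_affinePoint] at hx hx'
  exact ⟨y, by nlinarith, by nlinarith, rfl⟩

theorem isFAIET_glue {u : Fin p → Equiv.Perm I}
    (hu : ∀ i j, IsAffineOnIoo (u i) (cond j 0 (1 / 2)) (cond j (1 / 2) 1)) :
    IsFAIET (glue ha h0 h1 u) := by
  refine isFAIET_of_cover _ _ (halves_cover h0 h1) ?_
  rintro ⟨i, j⟩
  obtain ⟨l, b, hlb⟩ := hu i j
  refine ⟨l, a i.castSucc + (a i.succ - a i.castSucc) * b - l * a i.castSucc,
    fun x hx hx' => ?_⟩
  obtain ⟨y, hy, hy', rfl⟩ := exists_affinePoint_half ha h0 h1 hx hx'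
  rw [glue_affinePoint, coe_affinePoint, coe_affinePoint, hlb y hy hy']
  ring

end Glue

/-! ### Flips are commutators up to affine interval exchanges -/

theorem rot_half_of_lt {x : I} (hx : (x : ℝ) < 1 / 2) : (rot (1 / 2) x : ℝ) = x + 1 / 2 := by
  have := x.2.1
  rw [rot_apply, Int.fract_eq_self.2 ⟨by linarith, by linarith⟩, add_comm]

theorem rot_half_of_le {x : I} (hx : 1 / 2 ≤ (x : ℝ)) : (rot (1 / 2) x : ℝ) = x - 1 / 2 := by
  have := x.2.2
  rw [rot_apply, Int.fract_eq_iff]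
  exact ⟨by linarith, by linarith, 1, by push_cast; ring⟩

theorem rot_half_inv : (rot (1 / 2))⁻¹ = rot (1 / 2) := by
  ext x : 1
  rw [Equiv.Perm.inv_eq_iff_eq]
  apply Subtype.ext
  have h0 := x.2.1
  have h1 := x.2.2
  rcases lt_or_ge (x : ℝ) (1 / 2) with h | h
  · have := rot_half_of_lt h
    rw [rot_half_of_le (by linarith)]
    linarith
  · have := rot_half_of_le h
    rw [rot_half_of_lt (by linarith)]
    linarith

/-- The flip of the interval `(1/2,1)`, as a function. -/
noncomputable def halfFlipFun (x : I) : I :=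
  if h : 1 / 2 < (x : ℝ) then
    ⟨3 / 2 - x, Set.mem_Ico.2 (by have := x.2.2; constructor <;> linarith)⟩
  else x

theorem halfFlipFun_of_lt {x : I} (h : 1 / 2 < (x : ℝ)) : (halfFlipFun x : ℝ) = 3 / 2 - x := by
  rw [halfFlipFun, dif_pos h]

theorem halfFlipFun_of_le {x : I} (h : (x : ℝ) ≤ 1 / 2) : halfFlipFun x = x := by
  rw [halfFlipFun, dif_neg (not_lt.2 h)]

theorem halfFlipFun_involutive : Function.Involutive halfFlipFun := by
  intro x
  have := x.2.2
  rcases lt_or_ge (1 / 2) (x : ℝ) with h | h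
  · have e := halfFlipFun_of_lt h
    apply Subtype.ext
    rw [halfFlipFun_of_lt (by linarith)]
    linarith
  · rw [halfFlipFun_of_le h, halfFlipFun_of_le h]

/-- The flip of the interval `(1/2,1)`. -/
noncomputable def halfFlip : Equiv.Perm I := halfFlipFun_involutive.toPerm

theorem halfFlip_of_lt {x : I} (h : 1 / 2 < (x : ℝ)) : (halfFlip x : ℝ) = 3 / 2 - x :=
  halfFlipFun_of_lt h

theorem halfFlip_of_le {x : I} (h : (x : ℝ) ≤ 1 / 2) : halfFlip x = x := halfFlipFun_of_le h

theorem halfFlip_inv : halfFlip⁻¹ = halfFlip := Function.Involutive.toPerm_symm _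

/-- The flip of `(0,1)`, up to finitely many points, written with the exchange of the two halves and
a flip of one half. -/
theorem flip_apply {j : Bool} {x : I} (hx : cond j 0 (1 / 2) < (x : ℝ))
    (hx' : (x : ℝ) < cond j (1 / 2) 1) :
    ((rot (1 / 2) * halfFlip * (rot (1 / 2))⁻¹ * halfFlip⁻¹ * (rot (1 / 2))⁻¹ :
      Equiv.Perm I) x : ℝ) = 1 - x := by
  -- With `τ` the half exchange and `ρ` the flip of the right half, `τ ρ τ⁻¹` flips the left half.
  -- So `τ ρ τ⁻¹ ρ⁻¹ τ⁻¹` exchanges the halves and flips both, which reverses the whole interval.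
  simp only [rot_half_inv, halfFlip_inv, Equiv.Perm.mul_apply]
  cases j
  · simp only [cond_false] at hx hx'
    have e1 := rot_half_of_le hx.le
    have e2 := halfFlip_of_le (x := rot (1 / 2) x) (by linarith)
    rw [e2]
    have e3 := rot_half_of_lt (x := rot (1 / 2) x) (by linarith)
    have e4 := halfFlip_of_lt (x := rot (1 / 2) (rot (1 / 2) x)) (by linarith)
    rw [rot_half_of_le (by linarith)]
    linarith
  · simp only [cond_true] at hx hx'
    have e1 := rot_half_of_lt hx'
    have e2 := halfFlip_of_lt (x := rot (1 / 2) x) (by linarith)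
    have e3 := rot_half_of_le (x := halfFlip (rot (1 / 2) x)) (by linarith)
    rw [halfFlip_of_le (by linarith), rot_half_of_lt (by linarith)]
    linarith

/-- Every element of `𝒜(I)` is an element of `𝒜⁺(I)` times three conjugates of elements of
`𝒜⁺(I)`. -/
theorem exists_flipClass_eq (φ : AffineFlipHat) : ∃ (ψ T : AffinePlus) (R : AffineFlip),
    flipClass φ = plusClass ψ *
      (plusClass T * (R * (plusClass T)⁻¹ * R⁻¹) * (plusClass T)⁻¹)⁻¹ := by
  obtain ⟨φ, hφ⟩ := φ
  obtain ⟨p, a, ha, h0, h1, hP⟩ := id hφ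
  choose l b hlb using hP
  have hsub := isSub_of_subdivision ha h0 h1
  have hl0 : ∀ i, l i ≠ 0 := fun i => slope_ne_zero (hsub i).1 (hsub i).2.1 (hsub i).2.2 (hlb i)
  classical
  -- Only the pieces on which `φ` decreases are to be reversed; elsewhere the glued maps are
  -- trivial.
  let τ : Fin p → Equiv.Perm I := fun i => if l i < 0 then rot (1 / 2) else 1
  let ρ : Fin p → Equiv.Perm I := fun i => if l i < 0 then halfFlip else 1
  have hτ : IsAIET (glue ha h0 h1 τ) := by
    refine isAIET_glue ha h0 h1 fun i j => ?_
    by_cases h : l i < 0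
    · simp only [τ, if_pos h]
      cases j
      · exact ⟨1, -(1 / 2), one_pos, fun x hx _ => by rw [rot_half_of_le hx]; ring⟩
      · exact ⟨1, 1 / 2, one_pos, fun x _ hx => by rw [rot_half_of_lt hx]; ring⟩
    · simp only [τ, if_neg h]
      exact ⟨1, 0, one_pos, fun x _ _ => by simp⟩
  have hρ : IsFAIET (glue ha h0 h1 ρ) := by
    refine isFAIET_glue ha h0 h1 fun i j => ?_
    by_cases h : l i < 0
    · simp only [ρ, if_pos h]
      cases j
      · exact ⟨-1, 3 / 2, fun x hx _ => by rw [halfFlip_of_lt hx]; ring⟩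
      · exact ⟨1, 0, fun x _ hx => by rw [halfFlip_of_le (le_of_lt hx)]; ring⟩
    · simp only [ρ, if_neg h]
      exact ⟨1, 0, fun x _ _ => by simp⟩
  let T : AffinePlus := ⟨_, hτ⟩
  let R : AffineFlipHat := ⟨_, hρ⟩
  let T' : AffineFlipHat := Subgroup.inclusion affinePlus_le T
  -- Precomposing `φ` with this word reverses its decreasing pieces up to finitely many points, so
  -- `g` has only positive slopes and represents an element of `𝒜⁺(I)`.
  let g : AffineFlipHat := ⟨φ, hφ⟩ * (T' * (R * T'⁻¹ * R⁻¹) * T'⁻¹)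
  have hg : ∀ j : Fin p × Bool, ∃ m k : ℝ, 0 < m ∧ ∀ x : I, halfLeft a j < x →
      (x : ℝ) < halfRight a j → ((g : Equiv.Perm I) x : ℝ) = m * x + k := by
    rintro ⟨i, j⟩
    have hW : ∀ x, (g : Equiv.Perm I) x = φ (glue ha h0 h1
        (τ * (ρ * τ⁻¹ * ρ⁻¹) * τ⁻¹) x) := by
      intro x
      simp only [map_mul, map_inv]
      rfl
    rcases lt_or_gt_of_ne (hl0 i) with hneg | hpos
    · refine ⟨-l i, l i * (a i.castSucc + a i.succ) + b i, by linarith, fun x hx hx' => ?_⟩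
      obtain ⟨y, hy, hy', rfl⟩ := exists_affinePoint_half ha h0 h1 hx hx'
      have e : (τ * (ρ * τ⁻¹ * ρ⁻¹) * τ⁻¹) i =
          rot (1 / 2) * halfFlip * (rot (1 / 2))⁻¹ * halfFlip⁻¹ * (rot (1 / 2))⁻¹ := by
        simp [τ, ρ, if_pos hneg, mul_assoc]
      have hy01 : 0 < (y : ℝ) ∧ (y : ℝ) < 1 := by
        cases j <;> simp only [cond_true, cond_false] at hy hy' <;> constructor <;> linarith
      have hac := (hsub i).2.1
      rw [hW, glue_affinePoint, e, hlb i, coe_affinePoint, flip_apply hy hy', coe_affinePoint]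
      · ring
      · rw [coe_affinePoint, flip_apply hy hy']; nlinarith
      · rw [coe_affinePoint, flip_apply hy hy']; nlinarith
    · refine ⟨l i, b i, hpos, fun x hx hx' => ?_⟩
      obtain ⟨y, hy, hy', rfl⟩ := exists_affinePoint_half ha h0 h1 hx hx'
      have e : (τ * (ρ * τ⁻¹ * ρ⁻¹) * τ⁻¹) i = 1 := by
        simp [τ, ρ, if_neg (not_lt.2 hpos.le)]
      have hy01 : 0 < (y : ℝ) := by
        cases j <;> simp only [cond_true, cond_false] at hy hy' <;> linarith
      have hac := (hsub i).2.1
      rw [hW, glue_affinePoint, e, Equiv.Perm.one_apply, hlb i]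
      · rw [coe_affinePoint]; nlinarith
      · exact (affinePoint_mem _ _).2
  obtain ⟨ψ, hψ, hfin⟩ := exists_isAIET_of_slopes_pos g.2 _ _ (halves_cover h0 h1) hg
  refine ⟨⟨ψ, hψ⟩, T, flipClass R, ?_⟩
  have hψg : plusClass ⟨ψ, hψ⟩ = flipClass g := flipClass_eq_of_finite hfin
  rw [hψg, map_mul, map_mul, map_mul, map_mul, map_mul, map_inv, map_inv]
  exact (mul_inv_cancel_right _ _).symm

/-! ### From `𝒜(I)` to `𝒜⁺(I)` and the bound of 128 conjugates -/

/-- A nontrivial element of `𝒜(I)` has a commutator which is a nontrivial element of `𝒜⁺(I)`. -/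
theorem exists_plusClass_eq_commutator {f : AffineFlipHat} (hf : flipClass f ≠ 1) :
    ∃ (u θ : AffinePlus), θ ≠ 1 ∧ plusClass θ = ⁅flipClass f, plusClass u⁆ := by
  have hinf := infinite_of_flipClass_ne_one hf
  obtain ⟨f, hf'⟩ := f
  obtain ⟨p, a, ha, h0, h1, hP⟩ := id hf'
  have hfin : ((fun x : I => (x : ℝ)) ⁻¹' Set.range a).Finite :=
    (Set.finite_range a).preimage Subtype.val_injective.injOn
  obtain ⟨x, hx, hxa⟩ := (hinf.sdiff hfin).nonempty
  have hfx : f x ≠ x := hx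
  obtain ⟨i, hi, hi'⟩ := exists_piece h0 h1 x.2.1 x.2.2
  have hlt : a i.castSucc < x := lt_of_le_of_ne hi fun he => hxa ⟨_, he⟩
  have hsub := isSub_of_subdivision ha h0 h1 i
  obtain ⟨l, b, hlb⟩ := hP i
  have hl0 : l ≠ 0 := slope_ne_zero hsub.1 hsub.2.1 hsub.2.2 hlb
  have hlabs : 0 < |l| := abs_pos.2 hl0
  have hgap : 0 < |(f x : ℝ) - x| := abs_pos.2 (sub_ne_zero.2 fun h => hfx (Subtype.ext h))
  -- The image of `[x, x + ε]` has `f x` as an endpoint and length `|l| * ε < |f x - x|`, so it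
  -- misses `x`.
  obtain ⟨ε, hε, hε1, hε2⟩ : ∃ ε : ℝ, 0 < ε ∧ x + ε < a i.succ ∧ |l| * ε < |(f x : ℝ) - x| := by
    refine ⟨min ((a i.succ - x) / 2) (|(f x : ℝ) - x| / (2 * |l|)),
      lt_min (by linarith) (div_pos hgap (by linarith)), ?_, ?_⟩
    · linarith [min_le_left ((a i.succ - x) / 2) (|(f x : ℝ) - x| / (2 * |l|))]
    · have h := mul_le_mul_of_nonneg_left
        (min_le_right ((a i.succ - x) / 2) (|(f x : ℝ) - x| / (2 * |l|))) hlabs.le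
      have e : |l| * (|(f x : ℝ) - x| / (2 * |l|)) = |(f x : ℝ) - x| / 2 := by field_simp
      rw [e] at h
      linarith
  have hx0 := x.2.1
  have hu : IsSub (x : ℝ) (x + ε) := ⟨hx0, by linarith, by linarith [hsub.2.2]⟩
  have hfz : ∀ z : I, x ≤ z → (z : ℝ) ≤ x + ε → (f z : ℝ) = l * z + b := fun z hz hz' =>
    hlb z (lt_of_lt_of_le hlt hz) (by linarith)
  have hfx' := hfz x le_rfl (by linarith)
  have hfe := hfz ⟨x + ε, by linarith, by linarith [hsub.2.2]⟩
    (show (x : ℝ) ≤ x + ε by linarith) le_rfl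
  have hfe01 := (f ⟨x + ε, by linarith, by linarith [hsub.2.2]⟩).2
  rw [hfe] at hfe01
  simp only at hfe01
  have hfx01 := (f x).2
  rw [hfx'] at hfx01
  let u : AffinePlus := ⟨scale hu (rot (1 / 2)),
    isAIET_scale hu (isAIET_rot one_half_pos one_half_lt_one)⟩
  have hux : (scale hu (rot (1 / 2)) x : ℝ) = x + ε / 2 := by
    have e : affinePoint hu ⟨0, by norm_num⟩ = x := Subtype.ext (by rw [coe_affinePoint]; simp)
    have h := scale_affinePoint hu (rot (1 / 2)) ⟨0, by norm_num⟩
    rw [e] at h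
    rw [h, coe_affinePoint, rot_half_of_lt (by norm_num)]
    ring
  -- Here `k` stands for `f u f⁻¹`, so that `⁅f, u⁆` is `k * u⁻¹`. This is nontrivial because `k`
  -- fixes `x` while `u` moves it.
  suffices h : ∃ k : AffinePlus, (k : Equiv.Perm I) x = x ∧
      {z | f (scale hu (rot (1 / 2)) z) ≠ (k : Equiv.Perm I) (f z)}.Finite by
    obtain ⟨k, hk, hkf⟩ := h
    refine ⟨u, k * u⁻¹, ?_, ?_⟩
    · intro hku
      have h1 : k = u := mul_inv_eq_one.1 hku
      rw [h1] at hk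
      have h2 : (scale hu (rot (1 / 2)) x : ℝ) = x := congrArg Subtype.val hk
      linarith
    · have h1 : flipClass ⟨f, hf'⟩ * plusClass u = plusClass k * flipClass ⟨f, hf'⟩ := by
        change flipClass _ * flipClass _ = flipClass _ * flipClass _
        rw [← map_mul, ← map_mul]
        exact flipClass_eq_of_finite hkf
      rw [commutatorElement_def, h1, mul_inv_cancel_right, map_mul, map_inv]
  rcases lt_or_gt_of_ne hl0 with hneg | hpos
  · have hk : IsSub (l * (x + ε) + b) (l * x + b) :=
      ⟨hfe01.1, by nlinarith, hfx01.2.le⟩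
    refine ⟨⟨scale hk (rot (1 / 2)),
      isAIET_scale hk (isAIET_rot one_half_pos one_half_lt_one)⟩,
      scale_mem_fixingOff hk _ x ?_, ?_⟩
    · rw [abs_of_neg hneg] at hε2
      have := mul_pos (neg_pos.2 hneg) hε
      rcases lt_abs.1 hε2 with h | h
      · left; linarith
      · right; linarith
    -- On a decreasing piece the half exchanges match under reflection except at the midpoint and
    -- the two endpoints, where the half-open conventions disagree.
    · have hfin3 : ((fun z : I => (z : ℝ)) ⁻¹' {(x : ℝ), x + ε / 2, x + ε}).Finite :=
        (Set.toFinite _).preimage Subtype.val_injective.injOn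
      refine hfin3.subset fun z hz => ?_
      by_contra hcon
      simp only [Set.mem_preimage, Set.mem_insert_iff, Set.mem_singleton_iff, not_or] at hcon
      obtain ⟨hz1, hz2, hz3⟩ := hcon
      apply hz
      change f (scale hu (rot (1 / 2)) z) = scale hk (rot (1 / 2)) (f z)
      by_cases hzx : x ≤ z ∧ (z : ℝ) < x + ε
      · have hfz' := hfz z hzx.1 hzx.2.le
        have hzlt : (x : ℝ) < z := lt_of_le_of_ne hzx.1 (Ne.symm hz1)
        obtain ⟨y, rfl⟩ := exists_affinePoint hu hzx.1 hzx.2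
        rw [coe_affinePoint] at hfz' hz2 hzlt
        have hy0 : 0 < (y : ℝ) := by
          by_contra hcon
          push Not at hcon
          nlinarith
        have hy1 := y.2.2
        have e : f (affinePoint hu y) = affinePoint hk ⟨1 - y, by linarith, by linarith⟩ :=
          Subtype.ext (by rw [hfz', coe_affinePoint]; ring)
        rw [e, scale_affinePoint, scale_affinePoint]
        apply Subtype.ext
        have hm := affinePoint_mem hu (rot (1 / 2) y)
        rw [hfz _ hm.1 hm.2.le, coe_affinePoint, coe_affinePoint]
        rcases lt_trichotomy (y : ℝ) (1 / 2) with h | h | h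
        · rw [rot_half_of_lt h, rot_half_of_le (by simp only; linarith)]
          ring
        · exact absurd (by rw [h]; ring) hz2
        · rw [rot_half_of_le h.le, rot_half_of_lt (by simp only; linarith)]
          ring
      · have hz4 : (z : ℝ) < x ∨ x + ε ≤ z := by
          by_contra hcon
          push Not at hcon
          exact hzx hcon
        rw [scale_mem_fixingOff hu _ z hz4, scale_mem_fixingOff hk]
        by_contra hcon
        push Not at hcon
        obtain ⟨y, hy⟩ := exists_affinePoint hk hcon.1 hcon.2
        have hy0 := y.2.1
        have hy1 := y.2.2
        have hw : f ⟨x + ε * (1 - y), by nlinarith, by nlinarith [hsub.2.2]⟩ = f z := by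
          rw [← hy]
          apply Subtype.ext
          rw [hfz _ (show (x : ℝ) ≤ x + ε * (1 - y) by nlinarith)
            (show (x : ℝ) + ε * (1 - y) ≤ x + ε by nlinarith), coe_affinePoint]
          ring
        have hw' := congrArg Subtype.val (f.injective hw)
        simp only at hw'
        rcases hz4 with h | h
        · nlinarith
        · exact hz3 (le_antisymm (by nlinarith) h)
  · have hk : IsSub (l * x + b) (l * (x + ε) + b) :=
      ⟨hfx01.1, by nlinarith, hfe01.2.le⟩
    refine ⟨⟨scale hk (rot (1 / 2)),
      isAIET_scale hk (isAIET_rot one_half_pos one_half_lt_one)⟩,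
      scale_mem_fixingOff hk _ x ?_, ?_⟩
    · rw [abs_of_pos hpos] at hε2
      have := mul_pos hpos hε
      rcases lt_abs.1 hε2 with h | h
      · left; linarith
      · right; linarith
    -- On an increasing piece the conjugation is exact, and no exceptional point occurs.
    · have hm : MapsAffinely f x (x + ε) (l * x + b) (l * (x + ε) + b) := by
        intro z hz hz'
        have e : l * (x + ε) + b - (l * x + b) = l * ε := by ring
        rw [hfz z hz hz'.le, e, add_sub_cancel_left, mul_div_cancel_right₀ _ hε.ne']
        ring
      have : {z | f (scale hu (rot (1 / 2)) z) ≠ scale hk (rot (1 / 2)) (f z)} = ∅ := by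
        rw [← conj_scale hu hk hm]
        ext z
        simp
      change {z | f (scale hu (rot (1 / 2)) z) ≠ scale hk (rot (1 / 2)) (f z)}.Finite
      rw [this]
      exact Set.finite_empty

/-- The commutator `θ` costs two conjugates of `f^{±1}`, so each element of `𝒜⁺(I)` costs `2 * 16 =
32`, and `φ` is a product of four conjugates of such elements or their inverses. -/
theorem isUniformlySimple_affineFlip : IsUniformlySimple AffineFlip := by
  refine isUniformlySimple_of_conjProd (MonoidHom.id AffineFlip) Function.injective_id (N := 128)
    (by norm_num) fun f _ hf φ _ => ?_
  have htop : (MonoidHom.id AffineFlip).range = ⊤ := MonoidHom.range_eq_top.2 Function.surjective_id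
  rw [htop]
  obtain ⟨f, rfl⟩ := QuotientGroup.mk'_surjective _ f
  obtain ⟨φ, rfl⟩ := QuotientGroup.mk'_surjective _ φ
  obtain ⟨u, θ, hθ, hu⟩ := exists_plusClass_eq_commutator (f := f) hf
  have hθ2 : ConjProd ⊤ (flipClass f) 2 (plusClass θ) := by
    rw [hu]
    have := (ConjProd.of_conj (f := flipClass f) (Subgroup.mem_top 1)).mul
      (ConjProd.of_conj_inv (f := flipClass f) (Subgroup.mem_top (plusClass u)))
    convert this using 1
    rw [commutatorElement_def]
    group
  have hplus : ∀ ψ : AffinePlus, ConjProd ⊤ (flipClass f) 32 (plusClass ψ) := fun ψ => by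
    have h := isRich_affinePlus.conjProd θ.2 (fun h => hθ (Subtype.ext h)) ψ.2
    exact hθ2.trans ((ConjProd.comap_of_injective (χ := AffinePlus.subtype)
      Subtype.val_injective (Subgroup.range_subtype _) h).map plusClass)
  obtain ⟨ψ, T, R, h⟩ := exists_flipClass_eq φ
  change ConjProd ⊤ (flipClass f) 128 (flipClass φ)
  rw [h]
  have hT := hplus T
  exact (hplus ψ).mul (((hT.mul (hT.inv.conj (Subgroup.mem_top R))).mul hT.inv).inv)

end IntervalExchange

theorem corollary1p13 :
    IsUniformlySimple IntervalExchange.PLPlusCircle ∧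
    IsUniformlySimple IntervalExchange.AffineFlip ∧
    IsUniformlySimple IntervalExchange.AffinePlus :=
  ⟨IntervalExchange.isUniformlySimple_PLPlusCircle, IntervalExchange.isUniformlySimple_affineFlip,
    IntervalExchange.isUniformlySimple_affinePlus⟩
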